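/- For a finite graph $G$ with $n\ge 2$ vertices whose adjacency matrix has eigenvalues $\lambda_1\ge\lambda_2\ge\dots\ge\lambda_n$, put $\lambda(G)=\max\{\lambda_2,-\lambda_n\}$. Let $\rho$ be the graph metric of $G$. The polygraph $G_{[1,2,3]}$ is the graph with vertex set $V(G)^3$ in which $(x_1,x_2,x_3)$ and $(y_1,y_2,y_3)$ are adjacent if and only if $[\rho(x_1,y_1),\rho(x_2,y_2),\rho(x_3,y_3)]=[1,2,3]$ as multisets. The clique complex of a graph $H$ is the simplicial complex whose faces are the nonempty finite sets of vertices that span a clique in $H$; its $2$-faces are the triangles of $H$. A finite simplicial complex $X$ has the $\alpha$-geometric overlap property if for every embedding (injective map) $V(X)\to\mathbb{R}^2$, extended affinely to the faces, there is a point of $\mathbb{R}^2$ that lies in the images of at least an $\alpha$-fraction of the $2$-faces of $X$. Theorem. There are absolute constants $d_0,\epsilon_0,\alpha_0>0$ such that, for every finite $d$-regular graph $G$ with girth larger than $9$, $d>d_0$ and $\lambda(G)<\epsilon_0 d$, the clique complex of $G_{[1,2,3]}$ has the $\alpha_0$-geometric overlap property. Explicitly, this holds with $d_0=1600$, $\epsilon_0=1/20$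 and $\alpha_0=1/100$. -/

import Mathlib

/-- `λ(G) = max {λ₂, -λₙ}`, where `λ₁ ≥ λ₂ ≥ ⋯ ≥ λₙ` are the eigenvalues (with multiplicity) of
the adjacency matrix of a finite graph `G` with `n ≥ 2` vertices; `eigenvalues₀` lists them in
decreasing order, starting with index `0`. (For `n ≤ 1`, where `λ₂` does not exist, it is `0`.) -/
noncomputable def secondEigenvalue {V : Type*} [Fintype V] [DecidableEq V]
    (G : SimpleGraph V) [DecidableRel G.Adj] : ℝ :=
  if h : 2 ≤ Fintype.card V then
    max ((G.isHermitian_adjMatrix ℝ).eigenvalues₀ ⟨1, by omega⟩)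
      (-(G.isHermitian_adjMatrix ℝ).eigenvalues₀ ⟨Fintype.card V - 1, by omega⟩)
  else 0

/-- The polygraph `G_S`: its vertices are the `m`-tuples of vertices of `G`, where `m` is the size
of the multiset `S`; distinct `x`, `y` are neighbors iff the multiset of the distances
`ρ(x i, y i)` is `S`. Distances are taken in `ℕ∞` (infinite between different components). -/
noncomputable def polygraph {V : Type*} (G : SimpleGraph V) (S : Multiset ℕ) :
    SimpleGraph (Fin (Multiset.card S) → V) where
  Adj x y := x ≠ y ∧
    (Finset.univ : Finset (Fin (Multiset.card S))).val.map (fun i => G.edist (x i) (y i)) =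
      S.map (fun k => (k : ℕ∞))
  symm := ⟨fun x y h => ⟨h.1.symm, by simpa only [SimpleGraph.edist_comm] using h.2⟩⟩
  loopless := ⟨fun _ h => h.1 rfl⟩

/-- The clique complex of a graph: its faces are the nonempty finite sets of vertices that span
a clique. -/
def cliqueComplex {W : Type*} (H : SimpleGraph W) : AbstractSimplicialComplex W where
  faces := {s | s.Nonempty ∧ H.IsClique (s : Set W)}
  isRelLowerSet_faces := by
    intro s hs
    refine ⟨hs.1, fun t hts ht => ⟨ht, ?_⟩⟩
    exact hs.2.subset (Finset.coe_subset.mpr hts)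
  singleton_mem := by
    intro v
    exact ⟨Finset.singleton_nonempty v, by simp⟩

/-- The set of `2`-faces (faces with three vertices) of a simplicial complex. -/
def twoFaces {W : Type*} (X : AbstractSimplicialComplex W) : Set (Finset W) :=
  {s | s ∈ X.faces ∧ s.card = 3}

/-- The `α`-geometric overlap property of a finite simplicial complex `X`: for every embedding
of the vertices into the plane, extended affinely to the faces, some point of the plane lies in
the images of at least an `α`-fraction of the `2`-faces of `X`. -/
def HasGeometricOverlap {W : Type*} [Finite W] (X : AbstractSimplicialComplex W) (α : ℝ) : Prop :=
  ∀ f : W → EuclideanSpace ℝ (Fin 2), Function.Injective f →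
    ∃ p : EuclideanSpace ℝ (Fin 2),
      α * ((twoFaces X).ncard : ℝ) ≤
        ({s | s ∈ twoFaces X ∧ p ∈ convexHull ℝ (f '' (s : Set W))}.ncard : ℝ)

/-!
Given many points in the plane, three suitable lines through a common point `p` cut out six sectors
which form two triples, rich in points when taken together, such that every triangle with one vertex
in each sector of a triple contains `p`. It remains to see that a positive proportion of the
triangles of `G_{[1,2,3]}` is transversal to one of the triples.

Triangles of `G_{[1,2,3]}` arise from tripods: three paths issue from a common center, of lengths
`(1, 2, 0)`, `(1, 1, 1)` and `(2, 0, 1)` in the three coordinates, and since `G` has no short cycles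
any two of their ends are generically at distances `1, 2, 3` in some order. The normalized adjacency
matrix of `G` contracts the complement of the constants by the factor `1 / 20`, and its powers and
tensor products inherit enough of this for walks to mix: the number of tripods with ends in
prescribed sets is close to what the densities of these sets predict. Conversely, as `G` has girth
greater than `9`, the vertices of a triangle of `G_{[1,2,3]}` are in each coordinate the ends of a
tripod, and the legs of the three tripods have total length `9`, so that there are at most
`8 n³ d⁹` triangles.
-/

open Finset
open scoped BigOperators

theorem exists_subset_card_eq_forall_le {W : Type*} [DecidableEq W] (key : W → ℝ) (Q : Finset W)
    {j : ℕ} (hj : j ≤ #Q) :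
    ∃ L ⊆ Q, #L = j ∧ ∀ l ∈ L, ∀ h ∈ Q \ L, key l ≤ key h := by
  induction j with
  | zero => exact ⟨∅, by simp, by simp, by simp⟩
  | succ j ih =>
    obtain ⟨L, hLQ, rfl, hL⟩ := ih (by omega)
    have hne : (Q \ L).Nonempty := by rw [← card_pos, card_sdiff_of_subset hLQ]; omega
    obtain ⟨q, hq, hmin⟩ := exists_min_image (Q \ L) key hne
    rw [mem_sdiff] at hq
    refine ⟨insert q L, insert_subset hq.1 hLQ, card_insert_of_notMem hq.2, ?_⟩
    intro l hl h hh
    have hh' : h ∈ Q \ L := sdiff_subset_sdiff le_rfl (subset_insert q L) hh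
    rcases mem_insert.1 hl with rfl | hl
    exacts [hmin h hh', hL l hl h hh']

section OrderStatistic

variable {W : Type*} (key : W → ℝ) (Q : Finset W) (j : ℕ) (hj : 0 < j) (hQ : j ≤ #Q)

/-- The `j`-th smallest value (counted from `1`, with multiplicity) of `key` on `Q`, as a min-max
over the `j`-element subsets; in this form it visibly depends continuously on `key`. -/
noncomputable def orderStatistic : ℝ :=
  (Q.powersetCard j).attach.inf' (attach_nonempty_iff.2 (powersetCard_nonempty.2 hQ))
    fun L => L.1.sup' (card_pos.1 (by rwa [(mem_powersetCard.1 L.2).2])) key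

theorem continuous_orderStatistic {X : Type*} [TopologicalSpace X] {key : X → W → ℝ}
    (hkey : ∀ w, Continuous fun t => key t w) :
    Continuous fun t => orderStatistic (key t) Q j hj hQ :=
  Continuous.finset_inf'_apply _ fun _ _ => Continuous.finset_sup'_apply _ fun w _ => hkey w

variable {key Q}

theorem orderStatistic_le_sup' {L : Finset W} (hLQ : L ⊆ Q) (hL : #L = j) (hne : L.Nonempty) :
    orderStatistic key Q j hj hQ ≤ L.sup' hne key :=
  inf'_le _ (mem_attach _ ⟨L, mem_powersetCard.2 ⟨hLQ, hL⟩⟩)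

theorem orderStatistic_le {c : ℝ} (h : ∀ q ∈ Q, key q ≤ c) :
    orderStatistic key Q j hj hQ ≤ c := by
  obtain ⟨L, hLQ, hL⟩ := exists_subset_card_eq hQ
  have hne : L.Nonempty := card_pos.1 (hL ▸ hj)
  exact (orderStatistic_le_sup' j hj hQ hLQ hL hne).trans (sup'_le _ _ fun q hq => h q (hLQ hq))

theorem le_orderStatistic {c : ℝ}
    (h : ∀ L ⊆ Q, #L = j → ∃ q ∈ L, c ≤ key q) : c ≤ orderStatistic key Q j hj hQ := by
  refine le_inf' _ _ fun L _ => ?_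
  have hL := mem_powersetCard.1 L.2
  obtain ⟨q, hq, hcq⟩ := h L hL.1 hL.2
  exact hcq.trans (le_sup' key hq)

theorem orderStatistic_le_orderStatistic_of_forall_le {D : Finset W} {i : ℕ} (hi : 0 < i)
    (hD : i ≤ #D) (h : ∀ q ∈ Q, ∀ v ∈ D, key q ≤ key v) :
    orderStatistic key Q j hj hQ ≤ orderStatistic key D i hi hD := by
  refine le_orderStatistic i hi hD fun L hLD hL => ?_
  obtain ⟨v, hv⟩ := card_pos.1 (hL ▸ hi)
  exact ⟨v, hv, orderStatistic_le j hj hQ fun q hq => h q hq v (hLD hv)⟩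

theorem exists_subset_le_orderStatistic_le [DecidableEq W] :
    ∃ L ⊆ Q, #L = j ∧ (∀ l ∈ L, key l ≤ orderStatistic key Q j hj hQ) ∧
      ∀ h ∈ Q \ L, orderStatistic key Q j hj hQ ≤ key h := by
  obtain ⟨L, hLQ, hLc, hL⟩ := exists_subset_card_eq_forall_le key Q hQ
  refine ⟨L, hLQ, hLc, fun l hl => le_orderStatistic j hj hQ fun M hMQ hM => ?_, fun h hh => ?_⟩
  · by_cases hlM : l ∈ M
    · exact ⟨l, hlM, le_rfl⟩
    · obtain ⟨q, hqM, hqL⟩ : ∃ q ∈ M, q ∉ L := by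
        by_contra! hML
        exact hlM (eq_of_subset_of_card_le hML (by rw [hM, hLc]) ▸ hl)
      exact ⟨q, hqM, hL l hl q (mem_sdiff.2 ⟨hMQ hqM, hqL⟩)⟩
  · exact (orderStatistic_le_sup' j hj hQ hLQ hLc (card_pos.1 (hLc ▸ hj))).trans
      (sup'_le _ _ fun l hl => hL l hl h hh)

end OrderStatistic

section CommonCut

variable {W : Type*} {x y : W → ℝ} {U D : Finset W}

theorem exists_forall_sub_mul_le_sub_mul (x : W → ℝ) (hsep : ∀ u ∈ U, ∀ v ∈ D, y v < y u) :
    ∃ t, ∀ u ∈ U, ∀ v ∈ D, x u - t * y u ≤ x v - t * y v := by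
  let slope : W × W → ℝ := fun p => (x p.1 - x p.2) / (y p.1 - y p.2)
  obtain ⟨t, ht⟩ := ((U ×ˢ D).image slope).bddAbove
  refine ⟨t, fun u hu v hv => ?_⟩
  have hslope : slope (u, v) ≤ t := ht (by
    exact_mod_cast mem_image_of_mem slope (mk_mem_product hu hv))
  rw [div_le_iff₀ (sub_pos.2 (hsep u hu v hv))] at hslope
  linarith

/-- Turning the direction of the line from one extreme slope to the other exchanges the order of
the two levels, so at some intermediate slope they agree. -/
theorem exists_common_cut [DecidableEq W] (x : W → ℝ) (hsep : ∀ u ∈ U, ∀ v ∈ D, y v < y u)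
    {i j : ℕ} (hi : 0 < i) (hiU : i ≤ #U) (hj : 0 < j) (hjD : j ≤ #D) :
    ∃ t m : ℝ,
      (∃ L ⊆ U, #L = i ∧ (∀ w ∈ L, x w - t * y w ≤ m) ∧ ∀ w ∈ U \ L, m ≤ x w - t * y w) ∧
      ∃ L ⊆ D, #L = j ∧ (∀ w ∈ L, x w - t * y w ≤ m) ∧ ∀ w ∈ D \ L, m ≤ x w - t * y w := by
  let key : ℝ → W → ℝ := fun t w => x w - t * y w
  have hcont : ∀ w, Continuous fun t => key t w := fun w => by fun_prop
  obtain ⟨t₁, ht₁⟩ := exists_forall_sub_mul_le_sub_mul x hsep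
  obtain ⟨t₂, ht₂⟩ := exists_forall_sub_mul_le_sub_mul (-x) hsep
  have hge : ∀ v ∈ D, ∀ u ∈ U, key (-t₂) v ≤ key (-t₂) u := fun v hv u hu => by
    have := ht₂ u hu v hv
    simp only [Pi.neg_apply, key] at this ⊢
    linarith
  obtain ⟨t, ht⟩ := intermediate_value_univ₂ (continuous_orderStatistic U i hi hiU hcont)
    (continuous_orderStatistic D j hj hjD hcont)
    (orderStatistic_le_orderStatistic_of_forall_le i hi hiU hj hjD ht₁)
    (orderStatistic_le_orderStatistic_of_forall_le j hj hjD hi hiU hge)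
  exact ⟨t, orderStatistic (key t) U i hi hiU, exists_subset_le_orderStatistic_le i hi hiU,
    ht ▸ exists_subset_le_orderStatistic_le j hj hjD⟩

end CommonCut

/-- The three cross products are barycentric weights of `0` unless they all vanish, which happens
only in degenerate positions; a separating functional treats both cases at once. -/
theorem exists_mul_add_mul_nonpos_of_quadrants {a c e : ℝ × ℝ} (ha : 0 ≤ a.1 ∧ 0 ≤ a.2)
    (hc : c.1 ≤ 0 ∧ 0 ≤ c.2) (he : 0 ≤ e.1 ∧ e.2 ≤ 0) (hce : c.2 * e.1 ≤ c.1 * e.2) (r s : ℝ) :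
    ∃ q ∈ ({a, c, e} : Set (ℝ × ℝ)), q.1 * r + q.2 * s ≤ 0 := by
  by_contra! hpos
  obtain ⟨hla, hlc, hle⟩ : 0 < a.1 * r + a.2 * s ∧ 0 < c.1 * r + c.2 * s ∧
      0 < e.1 * r + e.2 * s := ⟨hpos a (by simp), hpos c (by simp), hpos e (by simp)⟩
  have hβ : 0 ≤ e.1 * a.2 + -e.2 * a.1 := by nlinarith
  have hγ : 0 ≤ a.1 * c.2 + a.2 * -c.1 := by nlinarith
  have hcomb : (c.1 * e.2 - c.2 * e.1) * (a.1 * r + a.2 * s) +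
      (e.1 * a.2 + -e.2 * a.1) * (c.1 * r + c.2 * s) +
      (a.1 * c.2 + a.2 * -c.1) * (e.1 * r + e.2 * s) = 0 := by ring
  have hα_nonneg := mul_nonneg (sub_nonneg.2 hce) hla.le
  have hβ_zero : e.1 * a.2 + -e.2 * a.1 = 0 := by
    nlinarith [hcomb, mul_nonneg hβ hlc.le, mul_nonneg hγ hle.le]
  have hγ_zero : a.1 * c.2 + a.2 * -c.1 = 0 := by
    nlinarith [hcomb, mul_nonneg hβ hlc.le, mul_nonneg hγ hle.le]
  rw [add_eq_zero_iff_of_nonneg (mul_nonneg he.1 ha.2) (mul_nonneg (neg_nonneg.2 he.2) ha.1)]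
    at hβ_zero
  rw [add_eq_zero_iff_of_nonneg (mul_nonneg ha.1 hc.2) (mul_nonneg ha.2 (neg_nonneg.2 hc.1))]
    at hγ_zero
  have ha_ne : a.1 ≠ 0 ∨ a.2 ≠ 0 := by
    by_contra! h
    simp [h] at hla
  rcases ha_ne with h | h
  · have hc₂ : c.2 = 0 := by simpa [h] using hγ_zero.1
    have he₂ : e.2 = 0 := by simpa [h] using hβ_zero.2
    simp only [hc₂, he₂, zero_mul, add_zero] at hlc hle
    nlinarith [mul_pos hlc hle, mul_nonneg (neg_nonneg.2 hc.1) (mul_nonneg he.1 (sq_nonneg r))]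
  · have hc₁ : c.1 = 0 := by simpa [h] using hγ_zero.2
    have he₁ : e.1 = 0 := by simpa [h] using hβ_zero.1
    simp only [hc₁, he₁, zero_mul, zero_add] at hlc hle
    nlinarith [mul_pos hlc hle, mul_nonneg hc.2 (mul_nonneg (neg_nonneg.2 he.2) (sq_nonneg s))]

theorem zero_mem_convexHull_of_quadrants {a c e : ℝ × ℝ} (ha : 0 ≤ a.1 ∧ 0 ≤ a.2)
    (hc : c.1 ≤ 0 ∧ 0 ≤ c.2) (he : 0 ≤ e.1 ∧ e.2 ≤ 0) (hce : c.2 * e.1 ≤ c.1 * e.2) :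
    (0 : ℝ × ℝ) ∈ convexHull ℝ {a, c, e} := by
  by_contra hnot
  obtain ⟨l, u, hlu, hl⟩ := geometric_hahn_banach_point_closed (convex_convexHull ℝ _)
    (Set.Finite.isClosed_convexHull ℝ (Set.toFinite {a, c, e})) hnot
  obtain ⟨q, hq, hq_nonpos⟩ :=
    exists_mul_add_mul_nonpos_of_quadrants ha hc he hce (l (1, 0)) (l (0, 1))
  have hlq : l q = q.1 * l (1, 0) + q.2 * l (0, 1) := by
    rw [← smul_eq_mul, ← smul_eq_mul, ← map_smul, ← map_smul, ← map_add]
    simp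
  have hlq_pos := hl q (subset_convexHull ℝ _ hq)
  rw [map_zero] at hlu
  linarith

theorem zero_mem_convexHull_of_opposite_quadrants {a c e : ℝ × ℝ} (ha : a.1 ≤ 0 ∧ a.2 ≤ 0)
    (hc : c.1 ≤ 0 ∧ 0 ≤ c.2) (he : 0 ≤ e.1 ∧ e.2 ≤ 0) (hce : c.1 * e.2 ≤ c.2 * e.1) :
    (0 : ℝ × ℝ) ∈ convexHull ℝ {a, c, e} := by
  have h : (0 : ℝ × ℝ) ∈ convexHull ℝ {-a, -e, -c} :=
    zero_mem_convexHull_of_quadrants (by simpa using ha) (by simpa using he) (by simpa using hc)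
      (by simpa [mul_comm] using hce)
  have hneg : -({-a, -e, -c} : Set (ℝ × ℝ)) = {a, c, e} := by simp [Set.pair_comm]
  rw [← hneg, convexHull_neg]
  simpa using h

theorem mul_le_mul_of_div_add_le_div_add {c₁ c₂ e₁ e₂ : ℝ} (hc₁ : 0 ≤ c₁) (hc₂ : 0 ≤ c₂)
    (he₁ : 0 ≤ e₁) (he₂ : 0 ≤ e₂) (h : c₂ / (c₂ + c₁) ≤ e₂ / (e₂ + e₁)) :
    c₂ * e₁ ≤ c₁ * e₂ := by
  rcases (add_nonneg hc₂ hc₁).eq_or_lt with hc | hc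
  · obtain ⟨rfl, rfl⟩ := (add_eq_zero_iff_of_nonneg hc₂ hc₁).1 hc.symm
    simp
  rcases (add_nonneg he₂ he₁).eq_or_lt with he | he
  · obtain ⟨rfl, rfl⟩ := (add_eq_zero_iff_of_nonneg he₂ he₁).1 he.symm
    simp
  rw [div_le_div_iff₀ hc he] at h
  linarith

theorem exists_injective_add_mul {W : Type*} [Finite W] {f : W → ℝ × ℝ}
    (hf : Function.Injective f) :
    ∃ s : ℝ, Function.Injective fun w => (f w).2 + s * (f w).1 := by
  obtain ⟨s, hs⟩ := (Set.finite_range fun p : W × W =>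
    ((f p.2).2 - (f p.1).2) / ((f p.1).1 - (f p.2).1)).exists_notMem
  refine ⟨s, fun a b hab => ?_⟩
  simp only at hab
  by_contra hne
  by_cases hu : (f a).1 = (f b).1
  · exact hne (hf (Prod.ext hu (by simpa [hu] using hab)))
  · refine hs ⟨(a, b), ?_⟩
    rw [div_eq_iff (sub_ne_zero.2 hu)]
    linarith

/-- Two opposite quadrants are divided so that the slopes occurring in the lower parts are at most
those in the upper parts; each part then meets the complementary part of the other quadrant on the
correct side. -/
theorem exists_split_opposite_quadrants {W : Type*} [DecidableEq W] {g : W → ℝ × ℝ}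
    {Q₂ Q₄ : Finset W} (hQ₂ : ∀ w ∈ Q₂, (g w).1 ≤ 0 ∧ 0 ≤ (g w).2)
    (hQ₄ : ∀ w ∈ Q₄, 0 ≤ (g w).1 ∧ (g w).2 ≤ 0) (hdisj : Disjoint Q₂ Q₄) (hcard : #Q₂ = #Q₄) :
    ∃ S : Finset W, #(Q₂ ∩ S) = #(Q₄ \ S) ∧ #(Q₂ \ S) = #(Q₄ ∩ S) ∧
      (∀ c ∈ Q₂ ∩ S, ∀ e ∈ Q₄ \ S, (g c).2 * (g e).1 ≤ (g c).1 * (g e).2) ∧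
      ∀ c ∈ Q₂ \ S, ∀ e ∈ Q₄ ∩ S, (g c).1 * (g e).2 ≤ (g c).2 * (g e).1 := by
  obtain ⟨S, hSQ, hSc, hS⟩ := exists_subset_card_eq_forall_le
    (fun w => |(g w).2| / (|(g w).2| + |(g w).1|)) (Q₂ ∪ Q₄) (j := #Q₂)
    (card_le_card subset_union_left)
  have hslope : ∀ c ∈ S, ∀ e ∈ (Q₂ ∪ Q₄) \ S, |(g c).2| * |(g e).1| ≤ |(g c).1| * |(g e).2| :=
    fun c hc e he => mul_le_mul_of_div_add_le_div_add (abs_nonneg _) (abs_nonneg _)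
      (abs_nonneg _) (abs_nonneg _) (hS c hc e he)
  have hcardS : #(Q₂ ∩ S) + #(Q₄ ∩ S) = #Q₂ := by
    rw [← card_union_of_disjoint (hdisj.mono inter_subset_left inter_subset_left),
      ← union_inter_distrib_right, inter_eq_right.2 hSQ, hSc]
  have hcard₂ := card_sdiff_add_card_inter Q₂ S
  have hcard₄ := card_sdiff_add_card_inter Q₄ S
  refine ⟨S, by omega, by omega, fun c hc e he => ?_, fun c hc e he => ?_⟩
  · simp only [mem_inter, mem_sdiff] at hc he
    have h := hslope c hc.2 e (mem_sdiff.2 ⟨mem_union_right _ he.1, he.2⟩)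
    rw [abs_of_nonneg (hQ₂ c hc.1).2, abs_of_nonneg (hQ₄ e he.1).1,
      abs_of_nonpos (hQ₂ c hc.1).1, abs_of_nonpos (hQ₄ e he.1).2] at h
    linarith
  · simp only [mem_inter, mem_sdiff] at hc he
    have h := hslope e he.2 c (mem_sdiff.2 ⟨mem_union_left _ hc.1, hc.2⟩)
    rw [abs_of_nonneg (hQ₂ c hc.1).2, abs_of_nonneg (hQ₄ e he.1).1,
      abs_of_nonpos (hQ₂ c hc.1).1, abs_of_nonpos (hQ₄ e he.1).2] at h
    linarith

section Sectors

variable {W : Type*} [Fintype W]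

theorem exists_disjoint_forall_lt {y : W → ℝ} (hy : Function.Injective y) {k : ℕ}
    (hk : 2 * k ≤ Fintype.card W) :
    ∃ U D : Finset W, Disjoint U D ∧ #U = k ∧ #D = k ∧ ∀ u ∈ U, ∀ v ∈ D, y v < y u := by
  classical
  obtain ⟨D, -, hDc, hD⟩ := exists_subset_card_eq_forall_le y univ (j := k) (by
    rw [card_univ]; omega)
  obtain ⟨U, hUD, hUc⟩ := exists_subset_card_eq (s := univ \ D) (n := k) (by
    rw [card_sdiff_of_subset (subset_univ _), card_univ]; omega)
  have hdisj : Disjoint U D := disjoint_of_subset_left hUD sdiff_disjoint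
  refine ⟨U, D, hdisj, hUc, hDc, fun u hu v hv => (hD v hv u (hUD hu)).lt_of_ne fun h => ?_⟩
  exact disjoint_left.1 hdisj hu (hy h ▸ hv)

theorem exists_quadrants [DecidableEq W] {f : W → ℝ × ℝ} (hf : Function.Injective f) {k : ℕ}
    (hk : 0 < k) (hkW : 6 * k ≤ Fintype.card W) :
    ∃ (L : ℝ × ℝ →ᵃ[ℝ] ℝ × ℝ) (g : W → ℝ × ℝ) (Q₁ Q₂ Q₃ Q₄ : Finset W),
      (∀ w, L (g w) = f w) ∧
      (#Q₁ = k ∧ ∀ w ∈ Q₁, 0 ≤ (g w).1 ∧ 0 ≤ (g w).2) ∧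
      (#Q₂ = 2 * k ∧ ∀ w ∈ Q₂, (g w).1 ≤ 0 ∧ 0 ≤ (g w).2) ∧
      (#Q₃ = k ∧ ∀ w ∈ Q₃, (g w).1 ≤ 0 ∧ (g w).2 ≤ 0) ∧
      (#Q₄ = 2 * k ∧ ∀ w ∈ Q₄, 0 ≤ (g w).1 ∧ (g w).2 ≤ 0) ∧
      Disjoint Q₁ Q₂ ∧ Disjoint Q₃ Q₄ ∧ Disjoint (Q₁ ∪ Q₂) (Q₃ ∪ Q₄) := by
  obtain ⟨s, hs⟩ := exists_injective_add_mul hf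
  set y : W → ℝ := fun w => (f w).2 + s * (f w).1 with hy
  obtain ⟨U, D, hUD, hUc, hDc, hsep⟩ := exists_disjoint_forall_lt hs (k := 3 * k) (by omega)
  obtain ⟨t, m, ⟨U', hU', hU'c, hU'le, hU'ge⟩, ⟨D', hD', hD'c, hD'le, hD'ge⟩⟩ :=
    exists_common_cut (fun w => (f w).1) hsep (i := 2 * k) (j := k) (by omega) (by omega) hk
      (by omega)
  obtain ⟨y₀, hy₀D, hy₀U⟩ : ∃ y₀, (∀ v ∈ D, y v ≤ y₀) ∧ ∀ u ∈ U, y₀ ≤ y u := by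
    have hne : D.Nonempty := card_pos.1 (by omega)
    exact ⟨D.sup' hne y, fun v hv => le_sup' y hv, fun u hu =>
      sup'_le _ _ fun v hv => (hsep u hu v hv).le⟩
  let L : ℝ × ℝ →ᵃ[ℝ] ℝ × ℝ :=
    ((LinearMap.fst ℝ ℝ ℝ).smulRight (1, -s) +
      (LinearMap.snd ℝ ℝ ℝ).smulRight (t, 1 - s * t)).toAffineMap +
      AffineMap.const ℝ _ (m + t * y₀, y₀ - s * (m + t * y₀))
  refine ⟨L, fun w => ((f w).1 - t * y w - m, y w - y₀), U \ U', U', D', D \ D', fun w => ?_,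
    ⟨?_, fun w hw => ⟨sub_nonneg.2 (hU'ge w hw), sub_nonneg.2 (hy₀U w (mem_sdiff.1 hw).1)⟩⟩,
    ⟨hU'c, fun w hw => ⟨sub_nonpos.2 (hU'le w hw), sub_nonneg.2 (hy₀U w (hU' hw))⟩⟩,
    ⟨hD'c, fun w hw => ⟨sub_nonpos.2 (hD'le w hw), sub_nonpos.2 (hy₀D w (hD' hw))⟩⟩,
    ⟨?_, fun w hw => ⟨sub_nonneg.2 (hD'ge w hw), sub_nonpos.2 (hy₀D w (mem_sdiff.1 hw).1)⟩⟩,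
    sdiff_disjoint, disjoint_sdiff, ?_⟩
  · ext <;> simp [L, hy] <;> ring
  · rw [card_sdiff_of_subset hU']; omega
  · rw [card_sdiff_of_subset hD']; omega
  · rwa [sdiff_union_of_subset hU', union_sdiff_of_subset hD']

theorem exists_overlap_sectors {E : Type*} [AddCommGroup E] [Module ℝ E] (φ : E ≃ₗ[ℝ] ℝ × ℝ)
    {f : W → E} (hf : Function.Injective f) {k : ℕ} (hk : 0 < k) (hkW : 6 * k ≤ Fintype.card W) :
    ∃ (p : E) (T : Fin 2 → Fin 3 → Finset W),
      (Pairwise fun a b : Fin 2 × Fin 3 => Disjoint (T a.1 a.2) (T b.1 b.2)) ∧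
      (∀ b, #(T b 0) = k ∧ #(T b 1) = #(T b 2)) ∧ #(T 0 1) + #(T 1 1) = 2 * k ∧
      ∀ b, ∀ v : Fin 3 → W, (∀ i, v i ∈ T b i) → p ∈ convexHull ℝ (Set.range (f ∘ v)) := by
  classical
  obtain ⟨L, g, Q₁, Q₂, Q₃, Q₄, hLg, ⟨hc₁, hQ₁⟩, ⟨hc₂, hQ₂⟩, ⟨hc₃, hQ₃⟩, ⟨hc₄, hQ₄⟩, h₁₂, h₃₄,
    hdisj⟩ := exists_quadrants (φ.injective.comp hf) hk hkW
  obtain ⟨S, hS₁, hS₂, hS₃, hS₄⟩ := exists_split_opposite_quadrants hQ₂ hQ₄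
    (hdisj.mono subset_union_right subset_union_right) (hc₂.trans hc₄.symm)
  have hcard₂ := card_sdiff_add_card_inter Q₂ S
  have htransport : ∀ v : Fin 3 → W, (0 : ℝ × ℝ) ∈ convexHull ℝ {g (v 0), g (v 1), g (v 2)} →
      φ.symm (L 0) ∈ convexHull ℝ (Set.range (f ∘ v)) := by
    intro v hv
    have hcomp : f ∘ v = φ.symm.toLinearMap.toAffineMap.comp L ∘ g ∘ v := by
      ext i; simp [hLg]
    rw [hcomp, Set.range_comp, ← AffineMap.image_convexHull]
    refine ⟨0, ?_, rfl⟩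
    convert hv
    ext q; simp [Fin.exists_fin_succ, eq_comm]
  refine ⟨φ.symm (L 0), ![![Q₁, Q₂ ∩ S, Q₄ \ S], ![Q₃, Q₂ \ S, Q₄ ∩ S]], ?_, ?_, ?_, ?_⟩
  · rintro ⟨b, i⟩ ⟨b', i'⟩ hne
    simp only [disjoint_left, mem_union, not_or] at h₁₂ h₃₄ hdisj ⊢
    intro w
    fin_cases b <;> fin_cases i <;> fin_cases b' <;> fin_cases i' <;> simp at hne ⊢ <;> grind
  · simp [Fin.forall_fin_two, hc₁, hc₃, hS₁, hS₂]
  · simp only [Matrix.cons_val]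
    omega
  · refine Fin.forall_fin_two.2 ⟨fun v hv => htransport v ?_, fun v hv => htransport v ?_⟩
    · exact zero_mem_convexHull_of_quadrants (hQ₁ _ (hv 0)) (hQ₂ _ (mem_inter.1 (hv 1)).1)
        (hQ₄ _ (mem_sdiff.1 (hv 2)).1) (hS₃ _ (hv 1) _ (hv 2))
    · exact zero_mem_convexHull_of_opposite_quadrants (hQ₃ _ (hv 0))
        (hQ₂ _ (mem_sdiff.1 (hv 1)).1) (hQ₄ _ (mem_inter.1 (hv 2)).1) (hS₄ _ (hv 1) _ (hv 2))

end Sectors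

section Girth

open SimpleGraph

variable {V : Type*} {G : SimpleGraph V} {u v w x y z : V}

theorem mem_edgeSet_fromEdgeSet_edges (p : G.Walk u v) {e : Sym2 V} (he : e ∈ p.edges) :
    e ∈ (fromEdgeSet {e | e ∈ p.edges}).edgeSet := by
  rw [edgeSet_fromEdgeSet]
  exact ⟨he, G.not_isDiag_of_mem_edgeSet (p.edges_subset_edgeSet he)⟩

theorem isAcyclic_fromEdgeSet_edges (p : G.Walk u v) (hp : p.length < G.egirth) :
    (fromEdgeSet {e | e ∈ p.edges}).IsAcyclic := by
  classical
  intro a c hc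
  have hle : fromEdgeSet {e | e ∈ p.edges} ≤ G := fun _ _ hab =>
    p.edges_subset_edgeSet ((fromEdgeSet_adj _).1 hab).1
  have hsub : c.edges.toFinset ⊆ p.edges.toFinset := fun e he => by
    have := c.edges_subset_edgeSet (List.mem_toFinset.1 he)
    rw [edgeSet_fromEdgeSet] at this
    exact List.mem_toFinset.2 this.1
  have hlength : c.length ≤ p.length := by
    rw [← Walk.length_edges, ← Walk.length_edges, ← List.toFinset_card_of_nodup hc.edges_nodup]
    exact (card_le_card hsub).trans (List.toFinset_card_le _)
  have hgirth := egirth_le_length ((Walk.isCycle_mapLe hle).2 hc)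
  rw [Walk.length_map] at hgirth
  exact (hp.trans_le hgirth).not_ge (by exact_mod_cast hlength)

theorem even_length_of_length_lt_egirth (p : G.Walk u u) (hp : p.length < G.egirth) :
    Even p.length := by
  simpa using two_colorable_iff_forall_loop_even.1
    (isAcyclic_fromEdgeSet_edges p hp).colorable_two u
    (p.transfer _ fun _ he => mem_edgeSet_fromEdgeSet_edges p he)

theorem eq_of_isPath_of_length_add_length_lt_egirth {p q : G.Walk u v} (hp : p.IsPath)
    (hq : q.IsPath) (h : (p.length + q.length : ℕ) < G.egirth) : p = q := by
  have hlength : (p.append q.reverse).length = p.length + q.length := by simp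
  have hacyclic := isAcyclic_fromEdgeSet_edges (p.append q.reverse) (hlength ▸ h)
  have hp' : ∀ e ∈ p.edges, e ∈ (fromEdgeSet {e | e ∈ (p.append q.reverse).edges}).edgeSet :=
    fun e he => mem_edgeSet_fromEdgeSet_edges _ (by simp [he])
  have hq' : ∀ e ∈ q.edges, e ∈ (fromEdgeSet {e | e ∈ (p.append q.reverse).edges}).edgeSet :=
    fun e he => mem_edgeSet_fromEdgeSet_edges _ (by simp [he])
  have heq := (hacyclic.subsingleton_path _ _).elim ⟨p.transfer _ hp', hp.transfer hp'⟩
    ⟨q.transfer _ hq', hq.transfer hq'⟩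
  apply Walk.ext_support
  simpa only [Walk.support_transfer] using congrArg (fun r => r.1.support) heq

theorem isPath_of_edist_eq_length {p : G.Walk u v} (hp : G.edist u v = p.length) : p.IsPath := by
  refine p.isPath_of_length_eq_dist ?_
  exact_mod_cast ((Reachable.coe_dist_eq_edist ⟨p⟩).trans hp).symm

theorem even_of_edist_eq {a b c : ℕ} (huv : G.edist u v = a) (huw : G.edist u w = b)
    (hvw : G.edist v w = c) (h : (a + b + c : ℕ) < G.egirth) : Even (a + b + c) := by
  obtain ⟨p, hp⟩ := exists_walk_of_edist_eq_coe huv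
  obtain ⟨q, hq⟩ := exists_walk_of_edist_eq_coe huw
  obtain ⟨r, hr⟩ := exists_walk_of_edist_eq_coe hvw
  have hlength : ((p.append r).append q.reverse).length = a + b + c := by
    simp only [Walk.length_append, Walk.length_reverse, hp, hq, hr]
    ring
  exact hlength ▸ even_length_of_length_lt_egirth ((p.append r).append q.reverse) (hlength ▸ h)

theorem edist_eq_add_one_or_of_adj {a : ℕ} (hxz : G.edist x z = a) (hzy : G.Adj z y)
    (h : (2 * a + 1 : ℕ) < G.egirth) :
    G.edist x y = (a + 1 : ℕ) ∨ ∃ b : ℕ, a = b + 1 ∧ G.edist x y = b := by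
  have hzy' : G.edist z y = (1 : ℕ) := by simpa using edist_eq_one_iff_adj.2 hzy
  have hle : G.edist x y ≤ (a + 1 : ℕ) := by
    simpa [hxz, hzy'] using G.edist_triangle (u := x) (v := z) (w := y)
  have hge : G.edist x z ≤ G.edist x y + 1 := by
    have := G.edist_triangle (u := x) (v := y) (w := z)
    rwa [G.edist_comm (u := y), hzy'] at this
  obtain ⟨b, hb⟩ := ENat.ne_top_iff_exists.1 (hle.trans_lt (ENat.natCast_lt_top _)).ne
  rw [← hb] at hle hge ⊢
  rw [hxz] at hge
  norm_cast at hle hge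
  rcases eq_or_ne b a with rfl | hba
  · have := even_of_edist_eq hxz hb.symm hzy' (by rwa [← two_mul])
    exact absurd this (by grind)
  · rcases hle.eq_or_lt with rfl | hlt
    · exact Or.inl rfl
    · exact Or.inr ⟨b, by omega, rfl⟩

theorem edist_eq_two_of_adj_of_adj (hg : 3 < G.egirth) (hxz : G.Adj x z) (hzy : G.Adj z y)
    (hne : x ≠ y) : G.edist x y = 2 := by
  have hxz' : G.edist x z = (1 : ℕ) := by simpa using edist_eq_one_iff_adj.2 hxz
  rcases edist_eq_add_one_or_of_adj hxz' hzy (by simpa using hg) with h | ⟨b, hb, h⟩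
  · exact h
  · obtain rfl : b = 0 := by omega
    exact absurd (edist_eq_zero_iff.1 h) hne

theorem eq_of_adj_of_adj (hg : 4 < G.egirth) (hne : u ≠ v) (hux : G.Adj u x) (hxv : G.Adj x v)
    (huy : G.Adj u y) (hyv : G.Adj y v) : x = y := by
  have hp : (Walk.cons hux (.cons hxv .nil)).IsPath := by
    simp [Walk.isPath_def, hux.ne, hxv.ne, hne]
  have hq : (Walk.cons huy (.cons hyv .nil)).IsPath := by
    simp [Walk.isPath_def, huy.ne, hyv.ne, hne]
  have heq := eq_of_isPath_of_length_add_length_lt_egirth hp hq (by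
    simp only [Walk.length_cons, Walk.length_nil]
    exact_mod_cast hg)
  simpa using congrArg Walk.support heq

/-- Otherwise the geodesics from the midpoint `m` of `u` and `v` to `w` through `u` and through `v`
would be two different paths of length `k + 2`. -/
theorem exists_adj_adj_edist_eq {k : ℕ} (hg : (2 * k + 4 : ℕ) < G.egirth)
    (huv : G.edist u v = 2) (huw : G.edist u w = (k + 1 : ℕ)) (hvw : G.edist v w = (k + 1 : ℕ)) :
    ∃ m, G.Adj m u ∧ G.Adj m v ∧ G.edist m w = k := by
  obtain ⟨hne, -, m, hm⟩ := edist_eq_two_iff.1 huv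
  obtain ⟨hum, hvm⟩ := (mem_commonNeighbors G).1 hm
  refine ⟨m, hum.symm, hvm.symm, ?_⟩
  have hlt : (2 * (k + 1) + 1 : ℕ) < G.egirth := lt_of_le_of_lt (by norm_cast; omega) hg
  rcases edist_eq_add_one_or_of_adj (by rwa [edist_comm] at huw) hum hlt with h | ⟨b, hb, h⟩
  · exfalso
    obtain ⟨p, hp⟩ := exists_walk_of_edist_eq_coe huw
    obtain ⟨q, hq⟩ := exists_walk_of_edist_eq_coe hvw
    have hp' : (Walk.cons hum.symm p).length = k + 1 + 1 := by simp [hp]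
    have hq' : (Walk.cons hvm.symm q).length = k + 1 + 1 := by simp [hq]
    have heq := eq_of_isPath_of_length_add_length_lt_egirth
      (isPath_of_edist_eq_length (p := .cons hum.symm p) (by rw [edist_comm, h, hp']))
      (isPath_of_edist_eq_length (p := .cons hvm.symm q) (by rw [edist_comm, h, hq']))
      (by rw [hp', hq']; exact lt_of_le_of_lt (by norm_cast; omega) hg)
    exact hne (by simpa using congrArg Walk.snd heq)
  · obtain rfl : b = k := by omega
    rwa [edist_comm]

end Girth

section Spectral

open Matrix
open scoped InnerProductSpace

theorem norm_sq_apply_le_of_inner_eq_zero {ι E : Type*} [Fintype ι] [NormedAddCommGroup E]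
    [InnerProductSpace ℝ E] {T : E →ₗ[ℝ] E} (hT : T.IsSymmetric) (b : OrthonormalBasis ι ℝ E)
    {ev : ι → ℝ} (hb : ∀ i, T (b i) = ev i • b i) {z : ι} {c μ : ℝ}
    (hc : ∀ i ≠ z, |ev i| ≤ c) (hcμ : c < μ) {v x : E} (hv : v ≠ 0) (hTv : T v = μ • v)
    (hx : ⟪v, x⟫_ℝ = 0) : ‖T x‖ ^ 2 ≤ c ^ 2 * ‖x‖ ^ 2 := by
  have hinner : ∀ i y, ⟪b i, T y⟫_ℝ = ev i * ⟪b i, y⟫_ℝ := fun i y => by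
    rw [← hT, hb, real_inner_smul_left]
  have hbv : ∀ i ≠ z, ⟪b i, v⟫_ℝ = 0 := fun i hi => by
    have h := hinner i v
    rw [hTv, real_inner_smul_right] at h
    have hne : μ ≠ ev i := ((le_of_abs_le (hc i hi)).trans_lt hcμ).ne'
    exact (mul_eq_mul_right_iff.1 h).resolve_left hne
  have hv_eq : v = ⟪b z, v⟫_ℝ • b z :=
    (b.sum_repr' v).symm.trans (Fintype.sum_eq_single z fun i hi => by rw [hbv i hi, zero_smul])
  have hbx : ⟪b z, x⟫_ℝ = 0 := by
    generalize ⟪b z, v⟫_ℝ = r at hv_eq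
    subst hv_eq
    rw [real_inner_smul_left] at hx
    exact (mul_eq_zero.1 hx).resolve_left (left_ne_zero_of_smul hv)
  rw [← b.sum_sq_inner_right, ← b.sum_sq_inner_right, mul_sum]
  refine sum_le_sum fun i _ => ?_
  rw [hinner, mul_pow]
  rcases eq_or_ne i z with rfl | hi
  · simp [hbx]
  · exact mul_le_mul_of_nonneg_right (sq_le_sq' (abs_le.1 (hc i hi)).1 (abs_le.1 (hc i hi)).2)
      (sq_nonneg _)

variable {V : Type*} [Fintype V] [DecidableEq V] (G : SimpleGraph V) [DecidableRel G.Adj]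

theorem exists_forall_ne_abs_eigenvalues_le [Nonempty V] :
    ∃ z, ∀ i ≠ z, |(G.isHermitian_adjMatrix ℝ).eigenvalues i| ≤ secondEigenvalue G := by
  set hA := G.isHermitian_adjMatrix ℝ
  let index : V ≃ Fin (Fintype.card V) := (Fintype.equivOfCardEq (Fintype.card_fin _)).symm
  refine ⟨index.symm ⟨0, Fintype.card_pos⟩, fun i hi => ?_⟩
  have hpos : 0 < (index i).1 := Nat.pos_of_ne_zero fun h => hi (by
    rw [Equiv.eq_symm_apply]
    exact Fin.ext h)
  have heig : hA.eigenvalues i = hA.eigenvalues₀ (index i) := rfl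
  have hcard : 2 ≤ Fintype.card V := by have := (index i).isLt; omega
  rw [secondEigenvalue, dif_pos hcard, heig, abs_le']
  constructor
  · exact le_max_of_le_left (hA.eigenvalues₀_antitone (Fin.le_def.2 hpos))
  · exact le_max_of_le_right (neg_le_neg (hA.eigenvalues₀_antitone
      (Fin.le_def.2 (Nat.le_sub_one_of_lt (index i).isLt))))

variable {G} {d : ℕ}

theorem sum_sq_adjMatrix_mulVec_le (hreg : G.IsRegularOfDegree d) {c : ℝ}
    (hc : secondEigenvalue G ≤ c) (hcd : c < d) {φ : V → ℝ} (hφ : ∑ v, φ v = 0) :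
    ∑ v, (G.adjMatrix ℝ *ᵥ φ) v ^ 2 ≤ c ^ 2 * ∑ v, φ v ^ 2 := by
  cases isEmpty_or_nonempty V
  · simp
  set hA := G.isHermitian_adjMatrix ℝ
  obtain ⟨z, hz⟩ := exists_forall_ne_abs_eigenvalues_le G
  have h := norm_sq_apply_le_of_inner_eq_zero (T := toEuclideanLin (G.adjMatrix ℝ))
    (isSymmetric_toEuclideanLin_iff.2 hA) hA.eigenvectorBasis (ev := hA.eigenvalues)
    (fun i => by
      ext v
      exact congrFun (hA.mulVec_eigenvectorBasis i) v)
    (fun i hi => (hz i hi).trans hc) hcd (v := WithLp.toLp 2 fun _ => 1)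
    (x := WithLp.toLp 2 φ) (fun h => ?_) ?_ ?_
  · simpa [EuclideanSpace.norm_sq_eq] using h
  · simpa using congrArg (fun x => x.ofLp (Classical.arbitrary V)) h
  · ext v
    simp [toLpLin_toLp, G.adjMatrix_mulVec_apply, hreg v]
  · simpa [PiLp.inner_apply] using hφ

end Spectral

section Kernels

open Matrix
open scoped Kronecker

/-- A symmetric matrix `K` that acts as the identity on the range of the orthogonal projection `P`
and contracts its orthogonal complement by the factor `ε`. The contraction is encoded as the
inequality `K² ≤ P + ε² (1 - P)` in the Loewner order, which behaves well under tensor products. -/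
structure IsContractingKernel {X : Type*} [Fintype X] [DecidableEq X] (K P : Matrix X X ℝ)
    (ε : ℝ) : Prop where
  isSymm : K.IsSymm
  isSymm_proj : P.IsSymm
  proj_mul_proj : P * P = P
  mul_proj : K * P = P
  posSemidef : (P + ε ^ 2 • (1 - P) - K * K).PosSemidef

theorem dotProduct_mul_self_mulVec {X : Type*} [Fintype X] {M : Matrix X X ℝ} (hM : M.IsSymm)
    (φ : X → ℝ) : φ ⬝ᵥ (M * M) *ᵥ φ = ∑ x, (M *ᵥ φ) x ^ 2 := by
  rw [← mulVec_mulVec, dotProduct_mulVec, ← mulVec_transpose, hM.eq]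
  simp only [dotProduct, sq]

theorem posSemidef_mul_self {X : Type*} [Fintype X] {M : Matrix X X ℝ} (hM : M.IsSymm) :
    (M * M).PosSemidef := by
  simpa [hM.eq] using posSemidef_conjTranspose_mul_self M

namespace IsContractingKernel

variable {X : Type*} [Fintype X] [DecidableEq X] {K P : Matrix X X ℝ} {ε : ℝ}

theorem proj_mul (hK : IsContractingKernel K P ε) : P * K = P := by
  simpa [hK.isSymm.eq, hK.isSymm_proj.eq] using congrArg transpose hK.mul_proj

theorem posSemidef_proj (hK : IsContractingKernel K P ε) : P.PosSemidef :=
  hK.proj_mul_proj ▸ posSemidef_mul_self hK.isSymm_proj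

theorem posSemidef_one_sub_proj (hK : IsContractingKernel K P ε) : (1 - P).PosSemidef := by
  have h := posSemidef_mul_self (isSymm_one.sub hK.isSymm_proj)
  rwa [sub_mul, one_mul, mul_sub, mul_one, hK.proj_mul_proj, sub_self, sub_zero] at h

theorem mono (hK : IsContractingKernel K P ε) (hε0 : 0 ≤ ε) {δ : ℝ} (h : ε ≤ δ) :
    IsContractingKernel K P δ where
  __ := hK
  posSemidef := by
    have hδ : 0 ≤ δ ^ 2 - ε ^ 2 := sub_nonneg.2 (pow_le_pow_left₀ hε0 h 2)
    convert hK.posSemidef.add (hK.posSemidef_one_sub_proj.smul hδ) using 1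
    module

theorem of_sum_sq_le (hK : K.IsSymm) (hP : P.IsSymm) (hPP : P * P = P) (hKP : K * P = P)
    (h : ∀ φ, P *ᵥ φ = 0 → ∑ x, (K *ᵥ φ) x ^ 2 ≤ ε ^ 2 * ∑ x, φ x ^ 2) :
    IsContractingKernel K P ε where
  isSymm := hK
  isSymm_proj := hP
  proj_mul_proj := hPP
  mul_proj := hKP
  posSemidef := by
    have hPK : P * K = P := by simpa [hK.eq, hP.eq] using congrArg transpose hKP
    have hfactor : P + ε ^ 2 • (1 - P) - K * K
        = (1 - P)ᵀ * ((ε ^ 2 • 1 - K * K) * (1 - P)) := by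
      simp only [transpose_sub, transpose_one, hP.eq, mul_sub, sub_mul, mul_one, one_mul,
        Matrix.mul_smul, Matrix.smul_mul, smul_sub, Matrix.mul_assoc, hKP, hPP]
      simp only [← Matrix.mul_assoc, hPK]
      abel
    refine .of_dotProduct_mulVec_nonneg (by simp [IsHermitian, hK.eq, hP.eq]) fun φ => ?_
    have hφ := h ((1 - P) *ᵥ φ) (by simp [mulVec_mulVec, mul_sub, hPP])
    rw [hfactor, ← mulVec_mulVec, ← mulVec_mulVec, star_trivial, dotProduct_mulVec,
      vecMul_transpose]
    generalize (1 - P) *ᵥ φ = ψ at hφ ⊢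
    rw [sub_mulVec, smul_mulVec, one_mulVec, dotProduct_sub, dotProduct_smul,
      dotProduct_mul_self_mulVec hK]
    simpa [dotProduct, sq] using hφ

theorem one : IsContractingKernel (1 : Matrix X X ℝ) 1 ε where
  isSymm := isSymm_one
  isSymm_proj := isSymm_one
  proj_mul_proj := mul_one 1
  mul_proj := mul_one 1
  posSemidef := by simpa using PosSemidef.zero

theorem pow_succ (hK : IsContractingKernel K P ε) (l : ℕ) :
    IsContractingKernel (K ^ (l + 1)) P (ε ^ (l + 1)) := by
  induction l with
  | zero => simpa using hK
  | succ l ih =>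
    exact {
      isSymm := hK.isSymm.pow _
      isSymm_proj := hK.isSymm_proj
      proj_mul_proj := hK.proj_mul_proj
      mul_proj := by rw [_root_.pow_succ, Matrix.mul_assoc, hK.mul_proj, ih.mul_proj]
      posSemidef := by
        have h := (ih.posSemidef.conjTranspose_mul_mul_same K).add
          (hK.posSemidef.smul (sq_nonneg (ε ^ (l + 1))))
        convert h using 1
        have hpow : K * (K ^ (l + 1) * K ^ (l + 1)) * K = K ^ (l + 1 + 1) * K ^ (l + 1 + 1) := by
          rw [← pow_add, ← pow_add, ← _root_.pow_succ', ← _root_.pow_succ]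
          congr 1
          ring
        rw [conjTranspose_eq_transpose_of_trivial, hK.isSymm.eq, mul_sub, sub_mul, hpow]
        simp only [mul_sub, sub_mul, mul_add, add_mul, Matrix.mul_smul, Matrix.smul_mul, smul_sub,
          smul_add, mul_one, hK.proj_mul, hK.mul_proj, smul_smul]
        module }

theorem pow (hK : IsContractingKernel K P ε) (hε0 : 0 ≤ ε) (hε : ε ≤ 1) (l : ℕ) :
    IsContractingKernel (K ^ l) (P ^ l) ε := by
  cases l with
  | zero => simpa using one
  | succ l =>
    have hP : IsIdempotentElem P := hK.proj_mul_proj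
    rw [hP.pow_succ_eq]
    exact (hK.pow_succ l).mono (pow_nonneg hε0 _) (pow_le_of_le_one hε0 hε l.succ_ne_zero)

theorem submatrix_equiv {Y : Type*} [Fintype Y] [DecidableEq Y] (hK : IsContractingKernel K P ε)
    (e : Y ≃ X) : IsContractingKernel (K.submatrix e e) (P.submatrix e e) ε where
  isSymm := hK.isSymm.submatrix e
  isSymm_proj := hK.isSymm_proj.submatrix e
  proj_mul_proj := by rw [submatrix_mul_equiv, hK.proj_mul_proj]
  mul_proj := by rw [submatrix_mul_equiv, hK.mul_proj]
  posSemidef := by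
    convert hK.posSemidef.submatrix e using 1
    rw [submatrix_mul_equiv, ← submatrix_one_equiv e]
    rfl

theorem kronecker {Y : Type*} [Fintype Y] [DecidableEq Y] {L Q : Matrix Y Y ℝ}
    (hK : IsContractingKernel K P ε) (hL : IsContractingKernel L Q ε) (hε0 : 0 ≤ ε)
    (hε : ε ≤ 1) : IsContractingKernel (K ⊗ₖ L) (P ⊗ₖ Q) ε where
  isSymm := by rw [IsSymm, ← kroneckerMap_transpose, hK.isSymm.eq, hL.isSymm.eq]
  isSymm_proj := by rw [IsSymm, ← kroneckerMap_transpose, hK.isSymm_proj.eq, hL.isSymm_proj.eq]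
  proj_mul_proj := by rw [← mul_kronecker_mul, hK.proj_mul_proj, hL.proj_mul_proj]
  mul_proj := by rw [← mul_kronecker_mul, hK.mul_proj, hL.mul_proj]
  posSemidef := by
    have hsq : 0 ≤ ε ^ 2 - ε ^ 4 := sub_nonneg.2 (pow_le_pow_of_le_one hε0 hε (by norm_num))
    have hQ := hL.posSemidef_proj.add (hL.posSemidef_one_sub_proj.smul (sq_nonneg ε))
    have hsplit : P ⊗ₖ Q + ε ^ 2 • (1 - P ⊗ₖ Q) - K ⊗ₖ L * K ⊗ₖ L
        = (P + ε ^ 2 • (1 - P) - K * K) ⊗ₖ (Q + ε ^ 2 • (1 - Q))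
          + (K * K) ⊗ₖ (Q + ε ^ 2 • (1 - Q) - L * L)
          + (ε ^ 2 - ε ^ 4) • (1 - P) ⊗ₖ (1 - Q) := by
      rw [← mul_kronecker_mul, ← one_kronecker_one]
      ext ⟨x, y⟩ ⟨x', y'⟩
      simp only [Matrix.add_apply, Matrix.sub_apply, Matrix.smul_apply, kroneckerMap_apply,
        smul_eq_mul]
      ring
    rw [hsplit]
    exact ((hK.posSemidef.kronecker hQ).add
      ((posSemidef_mul_self hK.isSymm).kronecker hL.posSemidef)).add
      ((hK.posSemidef_one_sub_proj.kronecker hL.posSemidef_one_sub_proj).smul hsq)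

theorem sum_sq_mulVec_sub_le (hK : IsContractingKernel K P ε) (φ : X → ℝ) :
    ∑ x, ((K *ᵥ φ) x - (P *ᵥ φ) x) ^ 2 ≤ ε ^ 2 * ∑ x, (φ x - (P *ᵥ φ) x) ^ 2 := by
  have hleft := dotProduct_mul_self_mulVec (hK.isSymm.sub hK.isSymm_proj) φ
  have hright := dotProduct_mul_self_mulVec (isSymm_one.sub hK.isSymm_proj) φ
  simp only [sub_mulVec, one_mulVec, Pi.sub_apply] at hleft hright
  have h := hK.posSemidef.dotProduct_mulVec_nonneg φ
  have hsplit : P + ε ^ 2 • (1 - P) - K * K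
      = ε ^ 2 • ((1 - P) * (1 - P)) - (K - P) * (K - P) := by
    simp only [sub_mul, mul_sub, mul_one, one_mul, hK.mul_proj, hK.proj_mul, hK.proj_mul_proj]
    module
  rw [hsplit, star_trivial, sub_mulVec, smul_mulVec, dotProduct_sub, dotProduct_smul, hleft,
    hright, smul_eq_mul] at h
  exact sub_nonneg.1 h

theorem sum_sq_mulVec_sub_le_sum_sq (hK : IsContractingKernel K P ε) (φ : X → ℝ) :
    ∑ x, ((K *ᵥ φ) x - (P *ᵥ φ) x) ^ 2 ≤ ε ^ 2 * ∑ x, φ x ^ 2 := by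
  refine (hK.sum_sq_mulVec_sub_le φ).trans (mul_le_mul_of_nonneg_left ?_ (sq_nonneg ε))
  have h := hK.posSemidef_proj.dotProduct_mulVec_nonneg φ
  have hproj := dotProduct_mul_self_mulVec (isSymm_one.sub hK.isSymm_proj) φ
  simp only [sub_mul, mul_sub, mul_one, one_mul, hK.proj_mul_proj, sub_self, sub_zero,
    sub_mulVec, one_mulVec, dotProduct_sub, Pi.sub_apply] at hproj
  rw [← hproj, sub_le_comm]
  simpa [dotProduct, sq] using h

end IsContractingKernel

end Kernels

section Averaging

open Matrix

variable {X : Type*} [Fintype X]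

/-- The kernel that replaces a function on a finite set by its mean value. -/
noncomputable def averagingKernel (X : Type*) [Fintype X] : Matrix X X ℝ :=
  Matrix.of fun _ _ => (Fintype.card X : ℝ)⁻¹

theorem averagingKernel_mulVec (φ : X → ℝ) (x : X) :
    (averagingKernel X *ᵥ φ) x = 𝔼 y, φ y := by
  rw [Fintype.expect_eq_sum_div_card, div_eq_inv_mul, mul_sum]
  rfl

theorem isSymm_averagingKernel : (averagingKernel X).IsSymm := rfl

theorem mul_averagingKernel [DecidableEq X] {K : Matrix X X ℝ} (hK : K ∈ rowStochastic ℝ X) :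
    K * averagingKernel X = averagingKernel X := by
  ext x y
  simp only [averagingKernel, mul_apply, of_apply, ← sum_mul, sum_row_of_mem_rowStochastic hK,
    one_mul]

theorem averagingKernel_mem_rowStochastic [DecidableEq X] [Nonempty X] :
    averagingKernel X ∈ rowStochastic ℝ X := by
  rw [mem_rowStochastic_iff_sum]
  exact ⟨fun _ _ => inv_nonneg.2 (Nat.cast_nonneg _), fun _ => by simp [averagingKernel]⟩

theorem mulVec_mem_Icc_of_mem_rowStochastic [DecidableEq X] {K : Matrix X X ℝ}
    (hK : K ∈ rowStochastic ℝ X) {φ : X → ℝ} (hφ : ∀ x, φ x ∈ Set.Icc 0 1) (x : X) :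
    (K *ᵥ φ) x ∈ Set.Icc 0 1 := by
  have hK0 := fun y => nonneg_of_mem_rowStochastic hK (i := x) (j := y)
  refine ⟨sum_nonneg fun y _ => mul_nonneg (hK0 y) (hφ y).1, ?_⟩
  rw [← sum_row_of_mem_rowStochastic hK x]
  exact sum_le_sum fun y _ => mul_le_of_le_one_right (hK0 y) (hφ y).2

/-- The variance of a function on a finite set with the uniform distribution. -/
noncomputable def finVariance (φ : X → ℝ) : ℝ := 𝔼 x, (φ x - 𝔼 y, φ y) ^ 2

theorem expect_mulVec_mul {K : Matrix X X ℝ} (hK : K.IsSymm) (φ ψ : X → ℝ) :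
    𝔼 x, (K *ᵥ φ) x * ψ x = 𝔼 x, φ x * (K *ᵥ ψ) x := by
  have h := dotProduct_mulVec φ K ψ
  rw [← mulVec_transpose, hK.eq] at h
  simp only [Fintype.expect_eq_sum_div_card]
  exact congrArg (· / _) h.symm

namespace IsContractingKernel

variable [DecidableEq X] {K P : Matrix X X ℝ} {ε : ℝ}

theorem expect_sq_mulVec_sub_le (hK : IsContractingKernel K P ε) (φ : X → ℝ) :
    𝔼 x, ((K *ᵥ φ) x - (P *ᵥ φ) x) ^ 2 ≤ ε ^ 2 * 𝔼 x, φ x ^ 2 := by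
  simp only [Fintype.expect_eq_sum_div_card, ← mul_div_assoc]
  exact div_le_div_of_nonneg_right (hK.sum_sq_mulVec_sub_le_sum_sq φ) (Nat.cast_nonneg _)

theorem expect_sq_mulVec_sub_expect_le (hK : IsContractingKernel K (averagingKernel X) ε)
    (φ : X → ℝ) : 𝔼 x, ((K *ᵥ φ) x - 𝔼 y, φ y) ^ 2 ≤ ε ^ 2 * finVariance φ := by
  have h := hK.sum_sq_mulVec_sub_le φ
  simp only [averagingKernel_mulVec] at h
  simp only [finVariance, Fintype.expect_eq_sum_div_card, ← mul_div_assoc] at h ⊢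
  exact div_le_div_of_nonneg_right h (Nat.cast_nonneg _)

theorem le_expect_mul_mulVec_sub [Nonempty X] (hK : IsContractingKernel K (averagingKernel X) ε)
    (hε : 0 < ε) (φ ψ : X → ℝ) :
    -(ε * (finVariance φ + finVariance ψ) / 2) ≤ 𝔼 x, φ x * ((K *ᵥ ψ) x - 𝔼 y, ψ y) := by
  set a := 𝔼 y, φ y
  set b := 𝔼 y, ψ y
  have hmean : 𝔼 x, ((K *ᵥ ψ) x - b) = 0 := by
    have h := expect_mulVec_mul hK.isSymm ψ 1
    have hone : K *ᵥ (1 : X → ℝ) = 1 := by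
      have hJ : averagingKernel X *ᵥ (1 : X → ℝ) = 1 :=
        funext fun x => by simp [averagingKernel_mulVec]
      rw [← hJ, mulVec_mulVec, hK.mul_proj]
    simp only [hone, Pi.one_apply, mul_one] at h
    rw [expect_sub_distrib, Fintype.expect_const, h, sub_self]
  have hpoint : ∀ s t : ℝ, -(ε * s ^ 2 + ε⁻¹ * t ^ 2) / 2 ≤ s * t := fun s t => by
    have h : 0 ≤ (ε * s + t) ^ 2 / (2 * ε) := by positivity
    have e : (ε * s + t) ^ 2 / (2 * ε) = (ε * s ^ 2 + ε⁻¹ * t ^ 2) / 2 + s * t := by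
      field_simp
      ring
    linarith
  calc -(ε * (finVariance φ + finVariance ψ) / 2)
      = -(ε * finVariance φ + ε⁻¹ * (ε ^ 2 * finVariance ψ)) / 2 := by
        field_simp
    _ ≤ -(ε * finVariance φ + ε⁻¹ * 𝔼 x, ((K *ᵥ ψ) x - b) ^ 2) / 2 := by
        have := hK.expect_sq_mulVec_sub_expect_le ψ
        gcongr
    _ = 𝔼 x, -(ε * (φ x - a) ^ 2 + ε⁻¹ * ((K *ᵥ ψ) x - b) ^ 2) / 2 := by
        rw [← expect_div, expect_neg_distrib, expect_add_distrib, ← mul_expect, ← mul_expect,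
          finVariance]
    _ ≤ 𝔼 x, (φ x - a) * ((K *ᵥ ψ) x - b) := expect_le_expect fun x _ => hpoint _ _
    _ = 𝔼 x, φ x * ((K *ᵥ ψ) x - b) := by
        simp only [sub_mul, expect_sub_distrib, ← mul_expect]
        rw [← expect_sub_distrib, hmean]
        simp [mul_sub]

theorem le_expect_mul_mulVec [Nonempty X] (hK : IsContractingKernel K (averagingKernel X) ε)
    (hε : 0 < ε) (φ ψ : X → ℝ) :
    (𝔼 x, φ x) * (𝔼 x, ψ x) - ε * (finVariance φ + finVariance ψ) / 2
      ≤ 𝔼 x, φ x * (K *ᵥ ψ) x := by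
  have h := hK.le_expect_mul_mulVec_sub hε φ ψ
  simp only [mul_sub, expect_sub_distrib, ← expect_mul] at h
  linarith

end IsContractingKernel

end Averaging

section Tensor

open Matrix

variable {ι V : Type*} [Fintype ι]

/-- The tensor product of the kernels `L i`, acting on functions of `ι → V`. -/
def tensorKernel (L : ι → Matrix V V ℝ) : Matrix (ι → V) (ι → V) ℝ :=
  Matrix.of fun m x => ∏ i, L i (m i) (x i)

theorem tensorKernel_apply (L : ι → Matrix V V ℝ) (m x : ι → V) :
    tensorKernel L m x = ∏ i, L i (m i) (x i) :=
  rfl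

theorem isSymm_tensorKernel {L : ι → Matrix V V ℝ} (hL : ∀ i, (L i).IsSymm) :
    (tensorKernel L).IsSymm := by
  ext m x
  exact prod_congr rfl fun i _ => (hL i).apply _ _

theorem isContractingKernel_tensorKernel [Fintype V] [DecidableEq V] {ε : ℝ} (hε0 : 0 ≤ ε)
    (hε : ε ≤ 1) {n : ℕ} {L P : Fin n → Matrix V V ℝ}
    (h : ∀ i, IsContractingKernel (L i) (P i) ε) :
    IsContractingKernel (tensorKernel L) (tensorKernel P) ε := by
  induction n with
  | zero =>
    have hone : ∀ M : Fin 0 → Matrix V V ℝ, tensorKernel M = 1 := fun M => by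
      ext m x
      rw [tensorKernel_apply, Subsingleton.elim m x, one_apply_eq, Fin.prod_univ_zero]
    rw [hone, hone]
    exact .one
  | succ n ih =>
    have hcons : ∀ M : Fin (n + 1) → Matrix V V ℝ, tensorKernel M =
        (kroneckerMap (· * ·) (M 0) (tensorKernel fun i => M i.succ)).submatrix
          (Fin.consEquiv fun _ => V).symm (Fin.consEquiv fun _ => V).symm := fun M => by
      ext m x
      simp only [tensorKernel_apply, Fin.prod_univ_succ]
      rfl
    rw [hcons, hcons]
    exact ((h 0).kronecker (ih fun i => h i.succ) hε0 hε).submatrix_equiv _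

variable [DecidableEq ι] [Fintype V]

theorem tensorKernel_mulVec_prod (L : ι → Matrix V V ℝ) (φ : ι → V → ℝ) (m : ι → V) :
    (tensorKernel L *ᵥ fun x => ∏ i, φ i (x i)) m = ∏ i, (L i *ᵥ φ i) (m i) := by
  simp only [mulVec, dotProduct, tensorKernel_apply, ← prod_mul_distrib]
  exact (Fintype.prod_sum fun i v => L i (m i) v * φ i v).symm

variable [DecidableEq V]

theorem tensorKernel_mulVec_finset_prod {L : ι → Matrix V V ℝ}
    (hL : ∀ i, L i ∈ rowStochastic ℝ V) (s : Finset ι) (φ : ι → V → ℝ) (m : ι → V) :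
    (tensorKernel L *ᵥ fun x => ∏ i ∈ s, φ i (x i)) m = ∏ i ∈ s, (L i *ᵥ φ i) (m i) := by
  have h := tensorKernel_mulVec_prod L (fun i => if i ∈ s then φ i else 1) m
  have hone : ∀ i, (L i *ᵥ if i ∈ s then φ i else 1) (m i) =
      if i ∈ s then (L i *ᵥ φ i) (m i) else 1 := fun i => by
    split_ifs
    exacts [rfl, congrFun (mem_rowStochastic.1 (hL i)).2 (m i)]
  simpa only [hone, ite_apply, Pi.one_apply, prod_ite_mem, univ_inter] using h

theorem tensorKernel_mulVec_apply {L : ι → Matrix V V ℝ} (hL : ∀ i, L i ∈ rowStochastic ℝ V)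
    (i : ι) (ψ : V → ℝ) (m : ι → V) :
    (tensorKernel L *ᵥ fun x => ψ (x i)) m = (L i *ᵥ ψ) (m i) := by
  simpa only [prod_singleton] using tensorKernel_mulVec_finset_prod hL {i} (fun _ => ψ) m

theorem tensorKernel_mem_rowStochastic {L : ι → Matrix V V ℝ}
    (hL : ∀ i, L i ∈ rowStochastic ℝ V) : tensorKernel L ∈ rowStochastic ℝ (ι → V) := by
  refine ⟨fun m x => prod_nonneg fun i _ => nonneg_of_mem_rowStochastic (hL i), funext fun m => ?_⟩
  exact tensorKernel_mulVec_finset_prod hL ∅ (fun _ => 1) m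

end Tensor

section Marginal

open Matrix

variable {ι V : Type*} [Fintype ι] [DecidableEq ι] [Fintype V]

/-- The marginal of `F : (ι → V) → ℝ` on the coordinate `i`: the conditional mean of `F` given the
value `v` of that coordinate. It is averaged over all of `ι → V`, overwriting the `i`-th
coordinate, so that no type of tuples indexed by `{j // j ≠ i}` is needed. -/
noncomputable def marginal (F : (ι → V) → ℝ) (i : ι) (v : V) : ℝ :=
  𝔼 x, F (Function.update x i v)

theorem expect_expect_update (F : (ι → V) → ℝ) (i : ι) :
    𝔼 x, 𝔼 v, F (Function.update x i v) = 𝔼 x, F x := by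
  rcases isEmpty_or_nonempty V with hV | hV
  · have : IsEmpty (ι → V) := ⟨fun x => hV.elim (x i)⟩
    simp only [univ_eq_empty, expect_empty]
  let swap : (ι → V) × V → (ι → V) × V := fun p => (Function.update p.1 i p.2, p.1 i)
  have hswap : Function.Involutive swap := fun p => by simp [swap]
  rw [← expect_product', univ_product_univ]
  calc 𝔼 p : (ι → V) × V, F (Function.update p.1 i p.2)
      = 𝔼 p : (ι → V) × V, F p.1 :=
        Fintype.expect_equiv hswap.toPerm (fun p => F (Function.update p.1 i p.2)) (fun p => F p.1)
          fun _ => rfl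
    _ = 𝔼 x, F x := by
        rw [← univ_product_univ, expect_product]
        simp only [Fintype.expect_const]

theorem expect_mul_apply (F : (ι → V) → ℝ) (i : ι) (ψ : V → ℝ) :
    𝔼 x, F x * ψ (x i) = 𝔼 v, marginal F i v * ψ v := by
  rw [← expect_expect_update _ i, expect_comm]
  simp only [Function.update_self, marginal, expect_mul]

theorem expect_marginal (F : (ι → V) → ℝ) (i : ι) : 𝔼 v, marginal F i v = 𝔼 x, F x := by
  rw [← expect_expect_update F i, expect_comm]
  rfl

theorem expect_eval [Nonempty V] (i : ι) (ψ : V → ℝ) : 𝔼 x : ι → V, ψ (x i) = 𝔼 v, ψ v := by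
  simp only [← expect_expect_update (fun x => ψ (x i)) i, Function.update_self,
    Fintype.expect_const]

theorem expect_eval_mul_eval [Nonempty V] {i j : ι} (hij : i ≠ j) (φ ψ : V → ℝ) :
    𝔼 x : ι → V, φ (x i) * ψ (x j) = (𝔼 v, φ v) * 𝔼 v, ψ v := by
  have h : marginal (fun x => φ (x i)) j = fun _ => 𝔼 v, φ v := funext fun v => by
    simp only [marginal, Function.update_of_ne hij, expect_eval]
  rw [expect_mul_apply (fun x => φ (x i)), h, mul_expect]

theorem marginal_mem_Icc [Nonempty V] {F : (ι → V) → ℝ} (hF : ∀ x, F x ∈ Set.Icc 0 1) (i : ι)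
    (v : V) : marginal F i v ∈ Set.Icc 0 1 :=
  ⟨expect_nonneg fun _ _ => (hF _).1, expect_le univ_nonempty fun _ _ => (hF _).2⟩

/-- The one-coordinate fluctuations of `F` are orthogonal, so this is Bessel's inequality. -/
theorem sum_finVariance_marginal_le [Nonempty V] (F : (ι → V) → ℝ) :
    ∑ i, finVariance (marginal F i) ≤ 𝔼 x, F x ^ 2 := by
  set θ : ι → V → ℝ := fun i v => marginal F i v - 𝔼 x, F x with hθ
  have hvar : ∀ i, finVariance (marginal F i) = 𝔼 v, θ i v ^ 2 := fun i => by
    simp only [finVariance, expect_marginal, hθ]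
  have hθ0 : ∀ i, 𝔼 v, θ i v = 0 := fun i => by
    simp only [hθ, expect_sub_distrib, expect_marginal, Fintype.expect_const, sub_self]
  have hcross : ∀ i, 𝔼 x, F x * θ i (x i) = finVariance (marginal F i) := fun i => by
    have h : 𝔼 v, (𝔼 x, F x) * θ i v = 0 := by rw [← mul_expect, hθ0, mul_zero]
    rw [expect_mul_apply, hvar, ← sub_zero (expect _ _), ← h, ← expect_sub_distrib]
    exact expect_congr rfl fun v _ => by simp only [hθ]; ring
  have horth : ∀ i j, 𝔼 x : ι → V, θ i (x i) * θ j (x j) =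
      if i = j then finVariance (marginal F i) else 0 := fun i j => by
    split_ifs with hij
    · subst hij
      simp only [hvar, ← sq]
      exact expect_eval i fun v => θ i v ^ 2
    · rw [expect_eval_mul_eval hij, hθ0, zero_mul]
  have hsq : 0 ≤ 𝔼 x, (F x - ∑ i, θ i (x i)) ^ 2 := expect_nonneg fun _ _ => sq_nonneg _
  have hexp : 𝔼 x, (F x - ∑ i, θ i (x i)) ^ 2 =
      𝔼 x, F x ^ 2 - 2 * ∑ i, finVariance (marginal F i) + ∑ i, finVariance (marginal F i) := by
    simp only [sub_sq, expect_add_distrib, expect_sub_distrib, mul_sum, sq (∑ i, θ i _),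
      sum_mul, expect_sum_comm, mul_assoc, ← mul_expect, hcross, horth]
    simp
  linarith

end Marginal

section Correlation

open Matrix

section

variable {ι V : Type*} [Fintype ι] [DecidableEq ι] [Fintype V] [DecidableEq V]

theorem averagingKernel_pow [Nonempty V] {l : ℕ} (hl : l ≠ 0) :
    averagingKernel V ^ l = averagingKernel V := by
  obtain ⟨l, rfl⟩ := Nat.exists_eq_succ_of_ne_zero hl
  have hidem : IsIdempotentElem (averagingKernel V) :=
    isIdempotentElem_iff.2 (mul_averagingKernel averagingKernel_mem_rowStochastic)
  exact hidem.pow_succ_eq l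

theorem tensorKernel_averagingKernel_pow [Nonempty V] {l : ι → ℕ} (hl : ∀ i, l i ≠ 0) :
    tensorKernel (fun i => averagingKernel V ^ l i) = averagingKernel (ι → V) := by
  ext m x
  simp only [tensorKernel_apply, averagingKernel_pow (hl _)]
  simp only [averagingKernel, of_apply, prod_const, card_univ, Fintype.card_fun, Nat.cast_pow,
    inv_pow]

theorem tensorKernel_averagingKernel_pow_mulVec [Nonempty V] {l : ι → ℕ} {i : ι} (hi : l i = 0)
    (hl : ∀ j ≠ i, l j ≠ 0) (F : (ι → V) → ℝ) (m : ι → V) :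
    (tensorKernel (fun j => averagingKernel V ^ l j) *ᵥ F) m = marginal F i (m i) := by
  have hn : (Fintype.card V : ℝ) ≠ 0 := Nat.cast_ne_zero.2 Fintype.card_ne_zero
  have hentry : ∀ x : ι → V, ∏ j, (averagingKernel V ^ l j) (m j) (x j) =
      (if m i = x i then (Fintype.card V : ℝ) else 0) / Fintype.card (ι → V) := fun x => by
    have hrest : ∀ j ∈ ({i}ᶜ : Finset ι),
        (averagingKernel V ^ l j) (m j) (x j) = (Fintype.card V : ℝ)⁻¹ := fun j hj => by
      rw [averagingKernel_pow (hl j (by simpa using hj))]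
      rfl
    rw [Fintype.prod_eq_mul_prod_compl i, hi, pow_zero, one_apply, prod_congr rfl hrest, prod_const,
      card_compl, card_singleton, Fintype.card_fun]
    have : Nonempty ι := ⟨i⟩
    obtain ⟨k, hk⟩ := Nat.exists_eq_succ_of_ne_zero (Fintype.card_ne_zero (α := ι))
    rw [hk, Nat.succ_sub_one, Nat.cast_pow, pow_succ, inv_pow]
    split_ifs
    · field_simp
    · simp only [zero_mul, zero_div]
  have hdirac : 𝔼 v, marginal F i v * (if m i = v then (Fintype.card V : ℝ) else 0) =
      marginal F i (m i) := by
    simp only [Fintype.expect_eq_sum_div_card, mul_ite, mul_zero, sum_ite_eq, mem_univ, if_true,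
      mul_div_cancel_right₀ _ hn]
  rw [← hdirac, ← expect_mul_apply, Fintype.expect_eq_sum_div_card, sum_div]
  refine sum_congr rfl fun x _ => ?_
  change tensorKernel _ m x * F x = _
  rw [tensorKernel_apply, hentry]
  ring

theorem neg_half_add_sq_le_mul_mul {s t r : ℝ} (hr : r ∈ Set.Icc 0 1) :
    -((s ^ 2 + t ^ 2) / 2) ≤ s * t * r := by
  obtain ⟨h0, h1⟩ := hr
  nlinarith [mul_nonneg h0 (sq_nonneg (s + t)), mul_nonneg (sub_nonneg.2 h1) (sq_nonneg s),
    mul_nonneg (sub_nonneg.2 h1) (sq_nonneg t)]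

theorem IsContractingKernel.le_expect_mul_mulVec_mul_mulVec [Nonempty V] {K : Matrix V V ℝ} {ε : ℝ}
    (hK : IsContractingKernel K (averagingKernel V) ε) (hε : 0 < ε) {G : (ι → V) → ℝ}
    (hG : ∀ x, G x ∈ Set.Icc 0 1) (i j : ι) {φ ψ : V → ℝ} (hφ : 0 ≤ 𝔼 v, φ v)
    (hψ : 0 ≤ 𝔼 v, ψ v) :
    (𝔼 x, G x) * (𝔼 v, φ v) * (𝔼 v, ψ v)
        - ε * ((𝔼 v, ψ v) * (finVariance (marginal G i) + finVariance φ)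
          + (𝔼 v, φ v) * (finVariance (marginal G j) + finVariance ψ)) / 2
        - ε ^ 2 * (finVariance φ + finVariance ψ) / 2
      ≤ 𝔼 x, G x * ((K *ᵥ φ) (x i) * (K *ᵥ ψ) (x j)) := by
  set a := 𝔼 v, φ v
  set b := 𝔼 v, ψ v
  set u : V → ℝ := fun v => (K *ᵥ φ) v - a with hu
  set w : V → ℝ := fun v => (K *ᵥ ψ) v - b with hw
  have hφ1 : -(ε * (finVariance (marginal G i) + finVariance φ) / 2) ≤ 𝔼 x, G x * u (x i) := by
    rw [expect_mul_apply]
    exact hK.le_expect_mul_mulVec_sub hε _ _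
  have hψ1 : -(ε * (finVariance (marginal G j) + finVariance ψ) / 2) ≤ 𝔼 x, G x * w (x j) := by
    rw [expect_mul_apply]
    exact hK.le_expect_mul_mulVec_sub hε _ _
  have hcross : -(ε ^ 2 * (finVariance φ + finVariance ψ) / 2)
      ≤ 𝔼 x, G x * (u (x i) * w (x j)) := by
    calc -(ε ^ 2 * (finVariance φ + finVariance ψ) / 2)
        ≤ -((𝔼 v, u v ^ 2 + 𝔼 v, w v ^ 2) / 2) := by
          linarith [hK.expect_sq_mulVec_sub_expect_le φ, hK.expect_sq_mulVec_sub_expect_le ψ]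
      _ = 𝔼 x : ι → V, -((u (x i) ^ 2 + w (x j) ^ 2) / 2) := by
          rw [← expect_eval i, ← expect_eval j fun v => w v ^ 2, ← expect_add_distrib, expect_div,
            expect_neg_distrib]
      _ ≤ 𝔼 x, G x * (u (x i) * w (x j)) := expect_le_expect fun x _ => by
          rw [mul_comm (G x)]
          exact neg_half_add_sq_le_mul_mul (hG x)
  have hsplit : 𝔼 x, G x * ((K *ᵥ φ) (x i) * (K *ᵥ ψ) (x j)) = 𝔼 x, G x * (u (x i) * w (x j))
      + b * 𝔼 x, G x * u (x i) + a * 𝔼 x, G x * w (x j) + (𝔼 x, G x) * (a * b) := by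
    simp only [mul_expect, expect_mul, ← expect_add_distrib]
    exact expect_congr rfl fun x _ => by simp only [hu, hw]; ring
  rw [hsplit]
  nlinarith [mul_le_mul_of_nonneg_left hφ1 hψ, mul_le_mul_of_nonneg_left hψ1 hφ]

end

namespace IsContractingKernel

variable {V : Type*} [Fintype V] [DecidableEq V] {K : Matrix V V ℝ} {ε : ℝ} {n : ℕ} {l : Fin n → ℕ}
  {F : (Fin n → V) → ℝ} {i j : Fin n} {φ ψ : V → ℝ}

theorem expect_sq_tensorKernel_pow_sub_le (hK : IsContractingKernel K (averagingKernel V) ε)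
    (hε0 : 0 ≤ ε) (hε : ε ≤ 1) (l : Fin n → ℕ) (hF : ∀ x, F x ∈ Set.Icc 0 1) :
    𝔼 m, ((tensorKernel (fun i => K ^ l i) *ᵥ F) m
      - (tensorKernel (fun i => averagingKernel V ^ l i) *ᵥ F) m) ^ 2 ≤ ε ^ 2 * 𝔼 x, F x :=
  ((isContractingKernel_tensorKernel hε0 hε fun i =>
    hK.pow hε0 hε (l i)).expect_sq_mulVec_sub_le F).trans <|
      mul_le_mul_of_nonneg_left (expect_le_expect fun x _ => by
        nlinarith [(hF x).1, (hF x).2]) (sq_nonneg ε)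

variable [Nonempty V]

theorem expect_sq_tensorKernel_pow_sub_expect_le
    (hK : IsContractingKernel K (averagingKernel V) ε) (hε0 : 0 ≤ ε) (hε : ε ≤ 1)
    (hl : ∀ i, l i ≠ 0) (hF : ∀ x, F x ∈ Set.Icc 0 1) :
    𝔼 m, ((tensorKernel (fun i => K ^ l i) *ᵥ F) m - 𝔼 x, F x) ^ 2 ≤ ε ^ 2 * 𝔼 x, F x := by
  simpa only [tensorKernel_averagingKernel_pow hl, averagingKernel_mulVec] using
    hK.expect_sq_tensorKernel_pow_sub_le hε0 hε l hF

theorem expect_sq_tensorKernel_pow_sub_marginal_le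
    (hK : IsContractingKernel K (averagingKernel V) ε) (hε0 : 0 ≤ ε) (hε : ε ≤ 1)
    (hi : l i = 0) (hl : ∀ j ≠ i, l j ≠ 0) (hF : ∀ x, F x ∈ Set.Icc 0 1) :
    𝔼 m, ((tensorKernel (fun i => K ^ l i) *ᵥ F) m - marginal F i (m i)) ^ 2
      ≤ ε ^ 2 * 𝔼 x, F x := by
  simpa only [tensorKernel_averagingKernel_pow_mulVec hi hl] using
    hK.expect_sq_tensorKernel_pow_sub_le hε0 hε l hF

theorem le_expect_tensorKernel_pow_mulVec_mul
    (hK : IsContractingKernel K (averagingKernel V) ε) (hKs : K ∈ rowStochastic ℝ V) (hε : 0 < ε)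
    {k : ℕ} (hi : l i = k + 1) (F : (Fin n → V) → ℝ) (ψ : V → ℝ) :
    (𝔼 x, F x) * (𝔼 v, ψ v) - ε ^ (k + 1) * (finVariance (marginal F i) + finVariance ψ) / 2
      ≤ 𝔼 m, (tensorKernel (fun i => K ^ l i) *ᵥ F) m * ψ (m i) := by
  rw [expect_mulVec_mul (isSymm_tensorKernel fun i => hK.isSymm.pow (l i)) F fun x => ψ (x i)]
  simp only [tensorKernel_mulVec_apply fun i => pow_mem hKs (l i), expect_mul_apply, hi]
  rw [← expect_marginal F i]
  exact (hK.pow_succ k).le_expect_mul_mulVec (by positivity) _ _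

theorem le_expect_tensorKernel_pow_mulVec_mul_mul
    (hK : IsContractingKernel K (averagingKernel V) ε) (hKs : K ∈ rowStochastic ℝ V) (hε : 0 < ε)
    (hij : i ≠ j) (hi : l i = 1) (hj : l j = 1) (hF : ∀ x, F x ∈ Set.Icc 0 1)
    (hφ : 0 ≤ 𝔼 v, φ v) (hψ : 0 ≤ 𝔼 v, ψ v) :
    (𝔼 x, F x) * (𝔼 v, φ v) * (𝔼 v, ψ v)
        - ε * ((𝔼 v, ψ v) * (finVariance (marginal F i) + finVariance φ)
          + (𝔼 v, φ v) * (finVariance (marginal F j) + finVariance ψ)) / 2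
        - ε ^ 2 * (finVariance φ + finVariance ψ) / 2
      ≤ 𝔼 m, (tensorKernel (fun i => K ^ l i) *ᵥ F) m * (φ (m i) * ψ (m j)) := by
  rw [expect_mulVec_mul (isSymm_tensorKernel fun i => hK.isSymm.pow (l i)) F
    fun x => φ (x i) * ψ (x j)]
  have hpair : ∀ f : Fin n → (V → ℝ) → V → ℝ, ∀ x : Fin n → V,
      ∏ k ∈ {i, j}, f k (if k = i then φ else ψ) (x k) = f i φ (x i) * f j ψ (x j) := fun f x => by
    rw [prod_pair hij, if_pos rfl, if_neg hij.symm]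
  have h := tensorKernel_mulVec_finset_prod (fun i => pow_mem hKs (l i)) {i, j}
    fun k => if k = i then φ else ψ
  simp only [hpair fun k φ => K ^ l k *ᵥ φ, hpair fun _ φ => φ, hi, hj, pow_one] at h
  simp only [h]
  exact hK.le_expect_mul_mulVec_mul_mulVec hε hF i j hφ hψ

end IsContractingKernel

end Correlation

section Tripod

open Matrix

/-- The distances, coordinate by coordinate, from the center of a tripod to its three ends. Any two
of the three legs add up to a permutation of `(1, 2, 3)`, which is what makes the ends of a
non-degenerate tripod pairwise adjacent in the polygraph. -/
def tripodLegs : Fin 3 → Fin 3 → ℕ := ![![1, 2, 0], ![1, 1, 1], ![2, 0, 1]]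

/-- The kernel from the center of a tripod to its `r`-th end, where `K` is the kernel of a step
of length one in each coordinate. -/
def tripodKernel {V : Type*} [Fintype V] [DecidableEq V] (K : Matrix V V ℝ) (r : Fin 3) :
    Matrix (Fin 3 → V) (Fin 3 → V) ℝ :=
  tensorKernel fun i => K ^ tripodLegs r i

theorem le_mul_mul_of_approx {f g h f₀ b h₀ : ℝ} (hh : h ∈ Set.Icc 0 1)
    (hf₀ : f₀ ∈ Set.Icc 0 1) (hb : 0 ≤ b) :
    b * (f * h₀) + g * (h₀ * f₀) + b * (h * f₀) - 2 * b * (f₀ * h₀)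
      - (((f - f₀) ^ 2 + (g - b) ^ 2) + b * ((f - f₀) ^ 2 + (h - h₀) ^ 2)
        + ((g - b) ^ 2 + (h - h₀) ^ 2)) / 2 ≤ f * g * h := by
  have hfg := neg_half_add_sq_le_mul_mul (s := f - f₀) (t := g - b) hh
  have hfh := mul_le_mul_of_nonneg_left (neg_half_add_sq_le_mul_mul (s := f - f₀) (t := h - h₀)
    (Set.right_mem_Icc.2 zero_le_one)) hb
  have hgh := neg_half_add_sq_le_mul_mul (s := g - b) (t := h - h₀) hf₀
  linarith

theorem le_expect_mul_mul_of_approx {X : Type*} [Fintype X] {f g h f₀ h₀ : X → ℝ} {b α β γ : ℝ}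
    (hh : ∀ x, h x ∈ Set.Icc 0 1) (hf₀ : ∀ x, f₀ x ∈ Set.Icc 0 1) (hb : 0 ≤ b)
    (hα : 𝔼 x, (f x - f₀ x) ^ 2 ≤ α) (hβ : 𝔼 x, (g x - b) ^ 2 ≤ β)
    (hγ : 𝔼 x, (h x - h₀ x) ^ 2 ≤ γ) :
    b * 𝔼 x, f x * h₀ x + 𝔼 x, g x * (h₀ x * f₀ x) + b * 𝔼 x, h x * f₀ x
      - 2 * b * 𝔼 x, f₀ x * h₀ x - ((α + β) + b * (α + γ) + (β + γ)) / 2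
      ≤ 𝔼 x, f x * g x * h x := by
  have hprod := expect_le_expect (s := univ) fun x _ =>
    le_mul_mul_of_approx (f := f x) (g := g x) (h₀ := h₀ x) (hh x) (hf₀ x) hb
  simp only [expect_add_distrib, expect_sub_distrib, ← mul_expect, ← expect_div] at hprod
  have hbα := mul_le_mul_of_nonneg_left hα hb
  have hbγ := mul_le_mul_of_nonneg_left hγ hb
  linarith

variable {V : Type*} [Fintype V] [DecidableEq V] [Nonempty V] {K : Matrix V V ℝ} {ε : ℝ}

theorem IsContractingKernel.le_expect_tripod (hK : IsContractingKernel K (averagingKernel V) ε)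
    (hKs : K ∈ rowStochastic ℝ V) (hε0 : 0 < ε) (hε : ε ≤ 1) {F : Fin 3 → (Fin 3 → V) → ℝ}
    (hF : ∀ r x, F r x ∈ Set.Icc 0 1) {a b c : ℝ} (ha : 𝔼 x, F 0 x = a) (hb : 𝔼 x, F 1 x = b)
    (hc : 𝔼 x, F 2 x = c) {v : Fin 3 → Fin 3 → ℝ}
    (hv : ∀ r i, finVariance (marginal (F r) i) = v r i) :
    a * b * c - b * (ε ^ 2 * (v 0 1 + v 2 1)) / 2
        - ε * (a * (v 1 1 + v 2 1) + c * (v 1 2 + v 0 2) + b * (v 0 2 + v 2 2)) / 2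
        - ε ^ 2 * (v 0 2 + v 2 1) / 2 - ε ^ 2 * (a + 2 * b + c + a * b + b * c) / 2
      ≤ 𝔼 m, ∏ r, (tripodKernel K r *ᵥ F r) m := by
  have ha0 : 0 ≤ a := ha ▸ expect_nonneg fun x _ => (hF 0 x).1
  have hb0 : 0 ≤ b := hb ▸ expect_nonneg fun x _ => (hF 1 x).1
  have hc0 : 0 ≤ c := hc ▸ expect_nonneg fun x _ => (hF 2 x).1
  set T : Fin 3 → (Fin 3 → V) → ℝ := fun r => tripodKernel K r *ᵥ F r
  set A := marginal (F 0) 2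
  set C := marginal (F 2) 1
  have hA : 𝔼 w, A w = a := by rw [expect_marginal, ha]
  have hC : 𝔼 w, C w = c := by rw [expect_marginal, hc]
  have h0 : 𝔼 m, (T 0 m - A (m 2)) ^ 2 ≤ ε ^ 2 * a := ha ▸
    hK.expect_sq_tensorKernel_pow_sub_marginal_le hε0.le hε rfl (by decide) (hF 0)
  have h1 : 𝔼 m, (T 1 m - b) ^ 2 ≤ ε ^ 2 * b := hb ▸
    hK.expect_sq_tensorKernel_pow_sub_expect_le hε0.le hε (by decide) (hF 1)
  have h2 : 𝔼 m, (T 2 m - C (m 1)) ^ 2 ≤ ε ^ 2 * c := hc ▸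
    hK.expect_sq_tensorKernel_pow_sub_marginal_le hε0.le hε rfl (by decide) (hF 2)
  have h0C : _ ≤ 𝔼 m, T 0 m * C (m 1) :=
    hK.le_expect_tensorKernel_pow_mulVec_mul hKs hε0 (l := tripodLegs 0) (i := 1) rfl _ _
  have h2A : _ ≤ 𝔼 m, T 2 m * A (m 2) :=
    hK.le_expect_tensorKernel_pow_mulVec_mul hKs hε0 (l := tripodLegs 2) (i := 2) rfl _ _
  have h1CA : _ ≤ 𝔼 m, T 1 m * (C (m 1) * A (m 2)) :=
    hK.le_expect_tensorKernel_pow_mulVec_mul_mul hKs hε0 (l := tripodLegs 1)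
      (i := 1) (j := 2) (by decide) rfl rfl (hF 1) (hC ▸ hc0) (hA ▸ ha0)
  rw [ha, hC, hv, hv] at h0C
  rw [hc, hA, hv, hv] at h2A
  rw [hb, hC, hA, hv, hv, hv, hv] at h1CA
  have hAC : 𝔼 m : Fin 3 → V, A (m 2) * C (m 1) = a * c := by
    rw [expect_eval_mul_eval (by decide), hA, hC]
  have hT2 : ∀ m, T 2 m ∈ Set.Icc 0 1 := mulVec_mem_Icc_of_mem_rowStochastic
    (tensorKernel_mem_rowStochastic fun i => pow_mem hKs _) (hF 2)
  have hprod := le_expect_mul_mul_of_approx hT2 (fun m => marginal_mem_Icc (hF 0) 2 (m 2)) hb0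
    h0 h1 h2
  rw [hAC] at hprod
  simp only [Fin.prod_univ_three]
  refine le_trans ?_ hprod
  linarith [mul_le_mul_of_nonneg_left h0C hb0, mul_le_mul_of_nonneg_left h2A hb0]

end Tripod

section Symmetrization

open Matrix

section

variable {ι V : Type*} [Fintype ι] [DecidableEq ι]

theorem expect_perm_apply (φ : ι → ℝ) (i : ι) : 𝔼 τ : Equiv.Perm ι, φ (τ i) = 𝔼 j, φ j := by
  have : Nonempty ι := ⟨i⟩
  have hindep : ∀ j, 𝔼 τ : Equiv.Perm ι, φ (τ j) = 𝔼 τ : Equiv.Perm ι, φ (τ i) := fun j =>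
    Fintype.expect_equiv (Equiv.mulRight (Equiv.swap i j)) _ _ fun τ => by simp
  calc 𝔼 τ : Equiv.Perm ι, φ (τ i) = 𝔼 j, 𝔼 τ : Equiv.Perm ι, φ (τ j) := by
        simp only [hindep, Fintype.expect_const]
    _ = 𝔼 τ : Equiv.Perm ι, 𝔼 j, φ j := by
        rw [expect_comm]
        exact expect_congr rfl fun τ _ => Fintype.expect_equiv τ _ _ fun _ => rfl
    _ = 𝔼 j, φ j := Fintype.expect_const _

variable [Fintype V]

theorem expect_comp_perm (F : (ι → V) → ℝ) (τ : Equiv.Perm ι) :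
    𝔼 x : ι → V, F (x ∘ τ) = 𝔼 x, F x :=
  Fintype.expect_equiv (Equiv.arrowCongr τ.symm (Equiv.refl V)) _ _ fun _ => rfl

theorem marginal_comp_perm (F : (ι → V) → ℝ) (τ : Equiv.Perm ι) (i : ι) :
    marginal (fun x => F (x ∘ τ)) i = marginal F (τ⁻¹ i) := by
  ext v
  rw [marginal, marginal, ← expect_comp_perm (fun x => F (Function.update x (τ⁻¹ i) v)) τ]
  simp only [Function.update_comp_equiv]
  rfl

theorem expect_perm_finVariance_marginal_le [Nonempty V] {F : (ι → V) → ℝ}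
    (hF : ∀ x, F x ∈ Set.Icc 0 1) (i : ι) :
    𝔼 τ : Equiv.Perm ι, finVariance (marginal (fun x => F (x ∘ τ)) i)
      ≤ (𝔼 x, F x) / Fintype.card ι := by
  calc 𝔼 τ : Equiv.Perm ι, finVariance (marginal (fun x => F (x ∘ τ)) i)
      = 𝔼 τ : Equiv.Perm ι, finVariance (marginal F (τ i)) := by
        simp only [marginal_comp_perm]
        exact Fintype.expect_equiv (Equiv.inv _) _ _ fun _ => rfl
    _ = (∑ j, finVariance (marginal F j)) / Fintype.card ι := by
        rw [expect_perm_apply fun j => finVariance (marginal F j), Fintype.expect_eq_sum_div_card]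
    _ ≤ (𝔼 x, F x) / Fintype.card ι := by
        gcongr
        refine (sum_finVariance_marginal_le F).trans (expect_le_expect fun x _ => ?_)
        nlinarith [(hF x).1, (hF x).2]

end

theorem sum_perm_fin_three {M : Type*} [AddCommMonoid M] (Φ : Fin 3 → Fin 3 → Fin 3 → M) :
    ∑ π : Equiv.Perm (Fin 3), Φ (π 0) (π 1) (π 2)
      = Φ 0 1 2 + Φ 0 2 1 + Φ 1 0 2 + Φ 1 2 0 + Φ 2 0 1 + Φ 2 1 0 := by
  have h : (univ : Finset (Equiv.Perm (Fin 3))) = {1, Equiv.swap 1 2, Equiv.swap 0 1,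
      Equiv.swap 0 1 * Equiv.swap 1 2, Equiv.swap 1 2 * Equiv.swap 0 1, Equiv.swap 0 2} := by
    decide
  rw [h]
  repeat rw [sum_insert (by decide)]
  rw [sum_singleton]
  simp only [← add_assoc]
  rfl

namespace IsContractingKernel

variable {V : Type*} [Fintype V] [DecidableEq V] [Nonempty V] {K : Matrix V V ℝ} {ε : ℝ}

theorem le_expect_perm_tripod (hK : IsContractingKernel K (averagingKernel V) ε)
    (hKs : K ∈ rowStochastic ℝ V) (hε0 : 0 < ε) (hε : ε ≤ 1) {F : Fin 3 → (Fin 3 → V) → ℝ}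
    (hF : ∀ r x, F r x ∈ Set.Icc 0 1) {a : Fin 3 → ℝ} (ha : ∀ r, 𝔼 x, F r x = a r) :
    a 0 * a 1 * a 2 - ε * (a 0 * a 1 + a 1 * a 2 + a 2 * a 0) / 3
        - 2 / 3 * ε ^ 2 * (a 1 * (a 0 + a 2)) - ε ^ 2 * (2 / 3 * (a 0 + a 2) + a 1)
      ≤ 𝔼 τ : Equiv.Perm (Fin 3), 𝔼 m, ∏ r, (tripodKernel K r *ᵥ fun x => F r (x ∘ τ)) m := by
  have ha0 : ∀ r, 0 ≤ a r := fun r => ha r ▸ expect_nonneg fun x _ => (hF r x).1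
  have h := expect_le_expect (s := univ) fun (τ : Equiv.Perm (Fin 3)) _ =>
    hK.le_expect_tripod hKs hε0 hε (fun r x => hF r (x ∘ τ))
      ((expect_comp_perm _ τ).trans (ha 0)) ((expect_comp_perm _ τ).trans (ha 1))
      ((expect_comp_perm _ τ).trans (ha 2)) fun _ _ => rfl
  refine le_trans ?_ h
  have hvar : ∀ r i, 𝔼 τ : Equiv.Perm (Fin 3), finVariance (marginal (fun x => F r (x ∘ τ)) i)
      ≤ a r / 3 := fun r i => by
    simpa only [ha, Fintype.card_fin, Nat.cast_ofNat] using
      expect_perm_finVariance_marginal_le (hF r) i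
  simp only [expect_add_distrib, expect_sub_distrib, ← mul_expect, ← expect_div,
    Fintype.expect_const]
  calc _ = a 0 * a 1 * a 2 - a 1 * (ε ^ 2 * (a 0 / 3 + a 2 / 3)) / 2
        - ε * (a 0 * (a 1 / 3 + a 2 / 3) + a 2 * (a 1 / 3 + a 0 / 3)
          + a 1 * (a 0 / 3 + a 2 / 3)) / 2
        - ε ^ 2 * (a 0 / 3 + a 2 / 3) / 2
        - ε ^ 2 * (a 0 + 2 * a 1 + a 2 + a 0 * a 1 + a 1 * a 2) / 2 := by ring
    _ ≤ _ := by gcongr <;> first | exact ha0 _ | exact hvar _ _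

end IsContractingKernel

end Symmetrization

section RegularTripod

open Matrix

variable {V : Type*} [Fintype V] [DecidableEq V]

theorem IsContractingKernel.le_expect_perm_perm_tripod [Nonempty V] {K : Matrix V V ℝ} {ε : ℝ}
    (hK : IsContractingKernel K (averagingKernel V) ε) (hKs : K ∈ rowStochastic ℝ V) (hε0 : 0 < ε)
    (hε : ε ≤ 1) {F : Fin 3 → (Fin 3 → V) → ℝ} (hF : ∀ r x, F r x ∈ Set.Icc 0 1) {a b c : ℝ}
    (ha : 𝔼 x, F 0 x = a) (hb : 𝔼 x, F 1 x = b) (hc : 𝔼 x, F 2 x = c) :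
    a * b * c - (ε / 3 + 4 / 9 * ε ^ 2) * (a * b + b * c + c * a) - 7 / 9 * ε ^ 2 * (a + b + c)
      ≤ 𝔼 π : Equiv.Perm (Fin 3), 𝔼 τ : Equiv.Perm (Fin 3), 𝔼 m,
          ∏ r, (tripodKernel K r *ᵥ fun x => F (π r) (x ∘ τ)) m := by
  set e : Fin 3 → ℝ := ![a, b, c] with he
  have hmean : ∀ r, 𝔼 x, F r x = e r := Fin.forall_fin_succ.2 ⟨ha, Fin.forall_fin_two.2 ⟨hb, hc⟩⟩
  refine le_trans (le_of_eq ?_) (expect_le_expect fun π _ =>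
    hK.le_expect_perm_tripod hKs hε0 hε (F := fun r => F (π r)) (fun r => hF (π r))
      fun r => hmean (π r))
  rw [Fintype.expect_eq_sum_div_card, sum_perm_fin_three fun i j k => e i * e j * e k
    - ε * (e i * e j + e j * e k + e k * e i) / 3 - 2 / 3 * ε ^ 2 * (e j * (e i + e k))
    - ε ^ 2 * (2 / 3 * (e i + e k) + e j), Fintype.card_perm, Fintype.card_fin]
  simp only [he, cons_val_zero, cons_val_one, Matrix.cons_val, Nat.factorial]
  norm_num
  ring

theorem tripodKernel_smul (c : ℝ) (M : Matrix V V ℝ) (r : Fin 3) :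
    tripodKernel (c • M) r = c ^ 3 • tripodKernel M r := by
  ext m x
  rw [tripodKernel, tensorKernel_apply, Matrix.smul_apply, tripodKernel, tensorKernel_apply]
  simp only [smul_pow, Matrix.smul_apply, smul_eq_mul, prod_mul_distrib, prod_pow_eq_pow_sum]
  congr 2
  revert r
  decide

variable {G : SimpleGraph V} [DecidableRel G.Adj] {d : ℕ}

theorem adjMatrix_pow_apply_nonneg (l : ℕ) (x y : V) : 0 ≤ (G.adjMatrix ℝ ^ l) x y := by
  rw [SimpleGraph.adjMatrix_pow_apply_eq_card_walk]
  exact Nat.cast_nonneg _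

theorem sum_adjMatrix_pow_apply (hreg : G.IsRegularOfDegree d) (l : ℕ) (x : V) :
    ∑ y, (G.adjMatrix ℝ ^ l) x y = (d : ℝ) ^ l := by
  have h : G.adjMatrix ℝ ^ l *ᵥ Function.const V 1 = Function.const V ((d : ℝ) ^ l) := by
    induction l with
    | zero => rw [pow_zero, one_mulVec, pow_zero]
    | succ l ih =>
      rw [pow_succ', ← mulVec_mulVec, ih]
      ext v
      rw [SimpleGraph.adjMatrix_mulVec_const_apply_of_regular hreg, Function.const_apply, pow_succ']
  simpa only [mulVec, dotProduct, Function.const_apply, mul_one] using congrFun h x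

theorem inv_smul_adjMatrix_mem_rowStochastic (hreg : G.IsRegularOfDegree d) (hd : d ≠ 0) :
    (d : ℝ)⁻¹ • G.adjMatrix ℝ ∈ rowStochastic ℝ V := by
  have hrow := sum_adjMatrix_pow_apply hreg 1
  simp only [pow_one] at hrow
  refine mem_rowStochastic_iff_sum.2 ⟨fun x y => ?_, fun x => ?_⟩
  · rw [Matrix.smul_apply, smul_eq_mul]
    simpa only [pow_one] using mul_nonneg (inv_nonneg.2 (Nat.cast_nonneg (α := ℝ) d))
      (adjMatrix_pow_apply_nonneg 1 x y)
  · simp only [Matrix.smul_apply, smul_eq_mul, ← mul_sum, hrow]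
    exact inv_mul_cancel₀ (Nat.cast_ne_zero.2 hd)

variable [Nonempty V]

theorem isContractingKernel_inv_smul_adjMatrix (hreg : G.IsRegularOfDegree d) (hd : d ≠ 0) {ε : ℝ}
    (hε : ε < 1) (hspec : secondEigenvalue G ≤ ε * d) :
    IsContractingKernel ((d : ℝ)⁻¹ • G.adjMatrix ℝ) (averagingKernel V) ε := by
  have hd0 : (0 : ℝ) < d := Nat.cast_pos.2 hd.pos
  refine .of_sum_sq_le ((G.isSymm_adjMatrix).smul _) isSymm_averagingKernel
    (mul_averagingKernel averagingKernel_mem_rowStochastic)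
    (mul_averagingKernel (inv_smul_adjMatrix_mem_rowStochastic hreg hd)) fun φ hφ => ?_
  have hsum : ∑ v, φ v = 0 := by
    have := congrFun hφ (Classical.arbitrary V)
    rwa [averagingKernel_mulVec, Fintype.expect_eq_sum_div_card, Pi.zero_apply,
      div_eq_zero_iff, or_iff_left (Nat.cast_ne_zero.2 Fintype.card_ne_zero)] at this
  simp only [smul_mulVec, Pi.smul_apply, smul_eq_mul, mul_pow, ← mul_sum]
  calc (d : ℝ)⁻¹ ^ 2 * ∑ v, (G.adjMatrix ℝ *ᵥ φ) v ^ 2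
      ≤ (d : ℝ)⁻¹ ^ 2 * ((ε * d) ^ 2 * ∑ v, φ v ^ 2) := by
        gcongr
        exact sum_sq_adjMatrix_mulVec_le hreg hspec (mul_lt_of_lt_one_left hd0 hε) hsum
    _ = ε ^ 2 * ∑ v, φ v ^ 2 := by field_simp

theorem le_sum_perm_perm_tripod (hreg : G.IsRegularOfDegree d) (hd : d ≠ 0) {ε : ℝ} (hε0 : 0 < ε)
    (hε : ε < 1) (hspec : secondEigenvalue G ≤ ε * d) {F : Fin 3 → (Fin 3 → V) → ℝ}
    (hF : ∀ r x, F r x ∈ Set.Icc 0 1) {a b c : ℝ} (ha : 𝔼 x, F 0 x = a) (hb : 𝔼 x, F 1 x = b)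
    (hc : 𝔼 x, F 2 x = c) :
    (Fintype.card V : ℝ) ^ 3 * d ^ 9 * (36 * (a * b * c)
        - (12 * ε + 16 * ε ^ 2) * (a * b + b * c + c * a) - 28 * ε ^ 2 * (a + b + c))
      ≤ ∑ π : Equiv.Perm (Fin 3), ∑ τ : Equiv.Perm (Fin 3), ∑ m,
          ∏ r, (tripodKernel (G.adjMatrix ℝ) r *ᵥ fun x => F (π r) (x ∘ τ)) m := by
  have hd0 : (d : ℝ) ≠ 0 := Nat.cast_ne_zero.2 hd
  have hn : (Fintype.card V : ℝ) ≠ 0 := Nat.cast_ne_zero.2 Fintype.card_ne_zero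
  have h := (isContractingKernel_inv_smul_adjMatrix hreg hd hε hspec).le_expect_perm_perm_tripod
    (inv_smul_adjMatrix_mem_rowStochastic hreg hd) hε0 hε.le hF ha hb hc
  simp only [tripodKernel_smul, smul_mulVec, Pi.smul_apply, smul_eq_mul, prod_mul_distrib,
    prod_const, card_univ, Fintype.card_fin, ← mul_expect] at h
  have hscale := mul_le_mul_of_nonneg_left h
    (by positivity : 0 ≤ 36 * ((Fintype.card V : ℝ) ^ 3 * (d : ℝ) ^ 9))
  refine le_trans (le_of_eq (by ring)) (hscale.trans (le_of_eq ?_))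
  simp only [Fintype.expect_eq_sum_div_card, Fintype.card_perm, Fintype.card_fin, Fintype.card_fun,
    ← sum_div, Nat.factorial]
  push_cast
  field_simp
  ring

end RegularTripod

section Weights

open Matrix

section

variable {ι κ V : Type*} [Fintype ι] [DecidableEq ι] [Fintype κ] [DecidableEq κ] [Fintype V]
  [DecidableEq V]

/-- The number of tripods with leg lengths `l` and ends `y` in a graph with adjacency matrix `M`,
where the legs are walks from a common center. -/
noncomputable def tripodWeight (M : Matrix V V ℝ) (l : κ → ℕ) (y : κ → V) : ℝ :=
  ∑ m, ∏ r, (M ^ l r) m (y r)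

theorem sum_prod_tensorKernel_pow_mulVec (M : Matrix V V ℝ) (l : κ → ι → ℕ)
    (f : κ → (ι → V) → ℝ) :
    ∑ m, ∏ r, (tensorKernel (fun i => M ^ l r i) *ᵥ f r) m
      = ∑ X : κ → ι → V,
          (∏ r, f r (X r)) * ∏ i, tripodWeight M (fun r => l r i) fun r => X r i := by
  simp only [tripodWeight, mulVec, dotProduct, tensorKernel_apply, Fintype.prod_sum, mul_sum]
  rw [sum_comm]
  refine sum_congr rfl fun X _ => sum_congr rfl fun m _ => ?_
  rw [prod_mul_distrib, prod_comm, mul_comm]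

theorem sum_apply_mul_prod_swap {β : Type*} [Fintype β] [DecidableEq β] (f : (ι → β) → ℝ)
    (g : ι → (κ → β) → ℝ) (r₀ : κ) :
    ∑ X : κ → ι → β, f (X r₀) * ∏ i, g i (fun r => X r i)
      = ∑ x, f x * ∏ i, ∑ y with y r₀ = x i, g i y := by
  calc ∑ X : κ → ι → β, f (X r₀) * ∏ i, g i (fun r => X r i)
      = ∑ Y : ι → κ → β, f (fun i => Y i r₀) * ∏ i, g i (Y i) :=
        Fintype.sum_equiv (Equiv.piComm _) _ _ fun _ => rfl
    _ = ∑ x, ∑ Y : ι → κ → β with (fun i => Y i r₀) = x, f x * ∏ i, g i (Y i) := by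
        rw [← sum_fiberwise univ fun Y : ι → κ → β => fun i => Y i r₀]
        refine sum_congr rfl fun x _ => sum_congr rfl fun Y hY => ?_
        rw [(mem_filter.1 hY).2]
    _ = ∑ x, f x * ∏ i, ∑ y with y r₀ = x i, g i y := by
        refine sum_congr rfl fun x _ => ?_
        rw [← mul_sum, prod_univ_sum]
        congr 2
        ext Y
        simp [funext_iff]

theorem sum_filter_apply_zero_eq {M : Type*} [AddCommMonoid M] (g : (Fin 3 → V) → M) (v : V) :
    ∑ y with y 0 = v, g y = ∑ a, ∑ b, g ![v, a, b] := by
  have heta : ∀ y : Fin 3 → V, y 0 = v → ![v, y 1, y 2] = y := by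
    rintro y rfl
    exact FinVec.etaExpand_eq y
  rw [← Fintype.sum_prod_type' (f := fun a b => g ![v, a, b])]
  exact sum_nbij' (fun y => (y 1, y 2)) (fun p => ![v, p.1, p.2]) (fun _ _ => mem_univ _)
    (fun _ _ => mem_filter.2 ⟨mem_univ _, rfl⟩) (fun y hy => heta y (mem_filter.1 hy).2)
    (fun _ _ => rfl) fun y hy => congrArg g (heta y (mem_filter.1 hy).2).symm

end

/-- Points are spread with leg lengths `l` if their mutual distances are those of the ends of a
tripod with legs of lengths `l`. -/
def IsSpread {κ V : Type*} (G : SimpleGraph V) (l : κ → ℕ) (y : κ → V) : Prop :=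
  Pairwise fun r s => G.edist (y r) (y s) = (l r + l s : ℕ)

theorem isSpread_vec3 {V : Type*} {G : SimpleGraph V} {a b c : ℕ} {x y z : V} :
    IsSpread G ![a, b, c] ![x, y, z] ↔ G.edist x y = (a + b : ℕ) ∧ G.edist x z = (a + c : ℕ) ∧
      G.edist y z = (b + c : ℕ) := by
  refine ⟨fun h => ⟨h (i := 0) (j := 1) (by decide), h (i := 0) (j := 2) (by decide),
    h (i := 1) (j := 2) (by decide)⟩, fun ⟨hxy, hxz, hyz⟩ r s hrs => ?_⟩
  fin_cases r <;> fin_cases s <;> first | exact absurd rfl hrs | assumption | skip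
  all_goals
    rw [G.edist_comm, add_comm]
    assumption

section Columns

section

variable {V : Type*} {G : SimpleGraph V} [DecidableRel G.Adj]

theorem adjMatrix_apply_nonneg (x y : V) : 0 ≤ G.adjMatrix ℝ x y := by
  rw [SimpleGraph.adjMatrix_apply]
  split_ifs
  exacts [zero_le_one, le_rfl]

theorem adjMatrix_apply_le_one (x y : V) : G.adjMatrix ℝ x y ≤ 1 := by
  rw [SimpleGraph.adjMatrix_apply]
  split_ifs
  exacts [le_rfl, zero_le_one]

theorem adj_and_adj_of_adjMatrix_mul_ne_zero {x y z w : V}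
    (h : G.adjMatrix ℝ x y * G.adjMatrix ℝ z w ≠ 0) : G.Adj x y ∧ G.Adj z w := by
  simpa only [SimpleGraph.adjMatrix_apply, ne_eq, mul_eq_zero, not_or, ite_eq_right_iff,
    one_ne_zero, imp_false, not_not] using h

end

variable {V : Type*} [Fintype V] [DecidableEq V] {G : SimpleGraph V} [DecidableRel G.Adj] {d : ℕ}

theorem adjMatrix_sq_apply_self (hreg : G.IsRegularOfDegree d) (x : V) :
    (G.adjMatrix ℝ ^ 2) x x = d := by
  rw [sq, SimpleGraph.adjMatrix_mul_self_apply_self, hreg x]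

theorem adjMatrix_sq_apply_le_one (hg : 4 < G.egirth) {x y : V} (hne : x ≠ y) :
    (G.adjMatrix ℝ ^ 2) x y ≤ 1 := by
  rw [sq, mul_apply]
  by_cases h : ∃ s, G.Adj x s ∧ G.Adj s y
  · obtain ⟨s, hxs, hsy⟩ := h
    rw [sum_eq_single s (fun t _ hts => by_contra fun h => ?_) (by simp)]
    · simp [hxs, hsy]
    · obtain ⟨hxt, hty⟩ := adj_and_adj_of_adjMatrix_mul_ne_zero h
      exact hts (eq_of_adj_of_adj hg hne hxt hty hxs hsy)
  · rw [sum_eq_zero fun s _ => by_contra fun hs => h ⟨s, adj_and_adj_of_adjMatrix_mul_ne_zero hs⟩]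
    exact zero_le_one

theorem adjMatrix_sq_apply_eq_zero (hg : 3 < G.egirth) {x y : V} (hne : x ≠ y)
    (hxy : G.edist x y ≠ 2) : (G.adjMatrix ℝ ^ 2) x y = 0 := by
  rw [sq, mul_apply]
  refine sum_eq_zero fun s _ => by_contra fun h => hxy ?_
  obtain ⟨hxs, hsy⟩ := adj_and_adj_of_adjMatrix_mul_ne_zero h
  exact edist_eq_two_of_adj_of_adj hg hxs hsy hne

theorem tripodWeight_vec3 (M : Matrix V V ℝ) (a b c : ℕ) (x y z : V) :
    tripodWeight M ![a, b, c] ![x, y, z] = ∑ m, (M ^ a) m x * (M ^ b) m y * (M ^ c) m z :=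
  sum_congr rfl fun _ _ => Fin.prod_univ_three _

theorem tripodWeight_zero_one_one (x y z : V) :
    tripodWeight (G.adjMatrix ℝ) ![0, 1, 1] ![x, y, z]
      = G.adjMatrix ℝ x y * G.adjMatrix ℝ x z := by
  simp only [tripodWeight_vec3, pow_zero, one_apply, pow_one, ite_mul, one_mul, zero_mul,
    sum_ite_eq', mem_univ, if_true]

theorem tripodWeight_two_one_zero (x y z : V) :
    tripodWeight (G.adjMatrix ℝ) ![2, 1, 0] ![x, y, z]
      = (G.adjMatrix ℝ ^ 2) z x * G.adjMatrix ℝ z y := by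
  simp only [tripodWeight_vec3, pow_zero, one_apply, pow_one, mul_ite, mul_one, mul_zero,
    sum_ite_eq', mem_univ, if_true]

theorem tripodWeight_one_one_two (x y z : V) :
    tripodWeight (G.adjMatrix ℝ) ![1, 1, 2] ![x, y, z]
      = ∑ m, G.adjMatrix ℝ m x * G.adjMatrix ℝ m y * (G.adjMatrix ℝ ^ 2) m z := by
  simp only [tripodWeight_vec3, pow_one]

theorem tripodWeight_zero_one_one_le_one (x y z : V) :
    tripodWeight (G.adjMatrix ℝ) ![0, 1, 1] ![x, y, z] ≤ 1 := by
  rw [tripodWeight_zero_one_one]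
  exact mul_le_one₀ (adjMatrix_apply_le_one x y) (adjMatrix_apply_nonneg x z)
    (adjMatrix_apply_le_one x z)

theorem tripodWeight_two_one_zero_le_one (hg : 4 < G.egirth) {x y z : V}
    (h : IsSpread G ![2, 1, 0] ![x, y, z]) :
    tripodWeight (G.adjMatrix ℝ) ![2, 1, 0] ![x, y, z] ≤ 1 := by
  rw [tripodWeight_two_one_zero]
  have hzx : z ≠ x := by
    rintro rfl
    simpa using (isSpread_vec3.1 h).2.1
  exact mul_le_one₀ (adjMatrix_sq_apply_le_one hg hzx) (adjMatrix_apply_nonneg z y)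
    (adjMatrix_apply_le_one z y)

theorem tripodWeight_one_one_two_le_one (hg : 4 < G.egirth) {x y z : V}
    (h : IsSpread G ![1, 1, 2] ![x, y, z]) :
    tripodWeight (G.adjMatrix ℝ) ![1, 1, 2] ![x, y, z] ≤ 1 := by
  obtain ⟨hxy, hxz, -⟩ := isSpread_vec3.1 h
  have hne : x ≠ y := by
    rintro rfl
    simp at hxy
  rw [tripodWeight_one_one_two]
  refine le_trans (sum_le_sum fun m _ => ?_) (sq (G.adjMatrix ℝ) ▸ adjMatrix_sq_apply_le_one hg hne)
  rw [← G.isSymm_adjMatrix.apply m x]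
  by_cases hm : G.Adj x m
  · have hmz : m ≠ z := by
      rintro rfl
      rw [SimpleGraph.edist_eq_one_iff_adj.2 hm] at hxz
      norm_num at hxz
    exact mul_le_of_le_one_right (mul_nonneg (adjMatrix_apply_nonneg _ _)
      (adjMatrix_apply_nonneg _ _)) (adjMatrix_sq_apply_le_one hg hmz)
  · simp [hm]

end Columns

end Weights

section Degenerate

open Matrix

variable {V : Type*} [Fintype V] [DecidableEq V] {G : SimpleGraph V} [DecidableRel G.Adj] {d : ℕ}

theorem tripodWeight_zero_one_one_le (hg : 3 < G.egirth) {x y z : V}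
    (h : ¬ IsSpread G ![0, 1, 1] ![x, y, z]) :
    tripodWeight (G.adjMatrix ℝ) ![0, 1, 1] ![x, y, z]
      ≤ if y = z then G.adjMatrix ℝ x y else 0 := by
  rw [tripodWeight_zero_one_one]
  split_ifs with hyz
  · exact mul_le_of_le_one_right (adjMatrix_apply_nonneg x y) (adjMatrix_apply_le_one x z)
  · refine (by_contra fun hne => h (isSpread_vec3.2 ?_) : _ = (0 : ℝ)).le
    obtain ⟨hxy, hxz⟩ := adj_and_adj_of_adjMatrix_mul_ne_zero hne
    exact ⟨SimpleGraph.edist_eq_one_iff_adj.2 hxy, SimpleGraph.edist_eq_one_iff_adj.2 hxz,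
      edist_eq_two_of_adj_of_adj hg hxy.symm hxz hyz⟩

theorem tripodWeight_two_one_zero_le (hg : 5 < G.egirth) (hreg : G.IsRegularOfDegree d) {x y z : V}
    (h : ¬ IsSpread G ![2, 1, 0] ![x, y, z]) :
    tripodWeight (G.adjMatrix ℝ) ![2, 1, 0] ![x, y, z]
      ≤ (if x = z then d * G.adjMatrix ℝ z y else 0) + G.adjMatrix ℝ z y * G.adjMatrix ℝ y x := by
  have hzy0 := adjMatrix_apply_nonneg (G := G) z y
  have hyx0 := adjMatrix_apply_nonneg (G := G) y x
  rw [tripodWeight_two_one_zero]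
  by_cases hxz : x = z
  · subst hxz
    rw [if_pos rfl, adjMatrix_sq_apply_self hreg]
    exact le_add_of_nonneg_right (mul_nonneg hzy0 hyx0)
  rw [if_neg hxz, zero_add]
  by_cases h2 : G.edist x z = 2
  swap
  · rw [adjMatrix_sq_apply_eq_zero (lt_trans (by norm_num) hg) (Ne.symm hxz)
      (G.edist_comm ▸ h2), zero_mul]
    exact mul_nonneg hzy0 hyx0
  by_cases hzy : G.Adj z y
  swap
  · simp [hzy]
  have hyx : G.Adj y x := by
    rcases edist_eq_add_one_or_of_adj (a := 2) h2 hzy (by simpa using hg) with h3 | ⟨b, hb, h1⟩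
    · exact absurd (isSpread_vec3.2 ⟨h3, h2, SimpleGraph.edist_eq_one_iff_adj.2 hzy.symm⟩) h
    · obtain rfl : b = 1 := by omega
      exact (SimpleGraph.edist_eq_one_iff_adj.1 h1).symm
  simpa [hzy, hyx] using adjMatrix_sq_apply_le_one (lt_trans (by norm_num) hg) (Ne.symm hxz)

theorem adjMatrix_sq_apply_le (hg : 5 < G.egirth) (hreg : G.IsRegularOfDegree d) {x y z m : V}
    (hxm : G.Adj x m) (hmy : G.Adj m y) (h : ¬ IsSpread G ![1, 1, 2] ![x, y, z]) :
    (G.adjMatrix ℝ ^ 2) m z ≤ (if x = y then (G.adjMatrix ℝ ^ 2) m z else 0)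
      + (if m = z then (d : ℝ) else 0) + G.adjMatrix ℝ z x + G.adjMatrix ℝ z y := by
  have hzx0 := adjMatrix_apply_nonneg (G := G) z x
  have hzy0 := adjMatrix_apply_nonneg (G := G) z y
  have hmz0 := adjMatrix_pow_apply_nonneg (G := G) 2 m z
  by_cases hmz : m = z
  · subst hmz
    rw [adjMatrix_sq_apply_self hreg, if_pos rfl]
    split_ifs <;> linarith [(Nat.cast_nonneg d : (0 : ℝ) ≤ d)]
  rw [if_neg hmz]
  by_cases hxy : x = y
  · rw [if_pos hxy]
    linarith
  rw [if_neg hxy]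
  by_cases h2 : G.edist z m = 2
  swap
  · rw [adjMatrix_sq_apply_eq_zero (lt_trans (by norm_num) hg) hmz (G.edist_comm ▸ h2)]
    linarith
  have hle := adjMatrix_sq_apply_le_one (lt_trans (by norm_num) hg) hmz
  have hclose : G.Adj z x ∨ G.Adj z y := by
    by_contra! hfar
    have hthree : ∀ {u}, G.Adj m u → ¬ G.Adj z u → G.edist u z = 3 := fun hmu hzu => by
      rcases edist_eq_add_one_or_of_adj (a := 2) h2 hmu (by simpa using hg) with h3 | ⟨b, hb, h1⟩
      · exact G.edist_comm.trans h3
      · obtain rfl : b = 1 := by omega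
        exact absurd (SimpleGraph.edist_eq_one_iff_adj.1 h1) hzu
    exact h (isSpread_vec3.2 ⟨edist_eq_two_of_adj_of_adj (lt_trans (by norm_num) hg) hxm hmy hxy,
      hthree hxm.symm hfar.1, hthree hmy hfar.2⟩)
  rcases hclose with hzx | hzy
  · linarith [show G.adjMatrix ℝ z x = 1 by simp [hzx]]
  · linarith [show G.adjMatrix ℝ z y = 1 by simp [hzy]]

theorem tripodWeight_one_one_two_le (hg : 5 < G.egirth) (hreg : G.IsRegularOfDegree d) {x y z : V}
    (h : ¬ IsSpread G ![1, 1, 2] ![x, y, z]) :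
    tripodWeight (G.adjMatrix ℝ) ![1, 1, 2] ![x, y, z]
      ≤ ∑ m, G.adjMatrix ℝ m x * G.adjMatrix ℝ m y *
          ((if x = y then (G.adjMatrix ℝ ^ 2) m z else 0) + (if m = z then (d : ℝ) else 0)
            + G.adjMatrix ℝ z x + G.adjMatrix ℝ z y) := by
  rw [tripodWeight_one_one_two]
  refine sum_le_sum fun m _ => ?_
  by_cases hm : G.adjMatrix ℝ m x * G.adjMatrix ℝ m y = 0
  · rw [hm, zero_mul, zero_mul]
  · obtain ⟨hmx, hmy⟩ := adj_and_adj_of_adjMatrix_mul_ne_zero hm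
    exact mul_le_mul_of_nonneg_left (adjMatrix_sq_apply_le hg hreg hmx.symm hmy h)
      (mul_nonneg (adjMatrix_apply_nonneg m x) (adjMatrix_apply_nonneg m y))

end Degenerate

section RootedSums

open Matrix

variable {V : Type*} [Fintype V] [DecidableEq V] {G : SimpleGraph V} [DecidableRel G.Adj] {d : ℕ}

open Classical in
/-- The number of tripods with leg lengths `l` and ends `y`, except that it is set to `0` where the
ends are spread: these are the tripods which the geometry of `G` forces to be degenerate. -/
noncomputable def degenerateTripodWeight {κ : Type*} [Fintype κ] (G : SimpleGraph V)
    [DecidableRel G.Adj] (l : κ → ℕ) (y : κ → V) : ℝ :=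
  if IsSpread G l y then 0 else tripodWeight (G.adjMatrix ℝ) l y

theorem tripodWeight_adjMatrix_nonneg {κ : Type*} [Fintype κ] (l : κ → ℕ) (y : κ → V) :
    0 ≤ tripodWeight (G.adjMatrix ℝ) l y :=
  sum_nonneg fun _ _ => prod_nonneg fun _ _ => adjMatrix_pow_apply_nonneg _ _ _

theorem degenerateTripodWeight_nonneg {κ : Type*} [Fintype κ] (l : κ → ℕ) (y : κ → V) :
    0 ≤ degenerateTripodWeight G l y := by
  rw [degenerateTripodWeight]
  split_ifs
  exacts [le_rfl, tripodWeight_adjMatrix_nonneg l y]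

omit [DecidableEq V] in
theorem sum_adjMatrix_apply (hreg : G.IsRegularOfDegree d) (x : V) :
    ∑ y, G.adjMatrix ℝ x y = d := by
  classical
  simpa only [pow_one] using sum_adjMatrix_pow_apply hreg 1 x

theorem sum_adjMatrix_pow_apply_left (hreg : G.IsRegularOfDegree d) (l : ℕ) (y : V) :
    ∑ x, (G.adjMatrix ℝ ^ l) x y = (d : ℝ) ^ l := by
  simp_rw [← (G.isSymm_adjMatrix.pow l).apply, sum_adjMatrix_pow_apply hreg]

omit [DecidableEq V] in
theorem sum_adjMatrix_apply_left (hreg : G.IsRegularOfDegree d) (y : V) :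
    ∑ x, G.adjMatrix ℝ x y = d := by
  classical
  simpa only [pow_one] using sum_adjMatrix_pow_apply_left hreg 1 y

theorem sum_tripodWeight (hreg : G.IsRegularOfDegree d) (a b c : ℕ) (v : V) :
    ∑ y with y 0 = v, tripodWeight (G.adjMatrix ℝ) ![a, b, c] y = (d : ℝ) ^ (a + b + c) := by
  simp only [sum_filter_apply_zero_eq, tripodWeight_vec3]
  rw [sum_comm_cycle]
  simp only [← mul_sum, ← sum_mul, sum_adjMatrix_pow_apply hreg, sum_adjMatrix_pow_apply_left hreg,
    pow_add]

theorem sum_zero_one_one_degenerate_le (hg : 3 < G.egirth)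
    (hreg : G.IsRegularOfDegree d) (v : V) :
    ∑ y with y 0 = v, degenerateTripodWeight G ![0, 1, 1] y ≤ d := by
  rw [sum_filter_apply_zero_eq]
  calc _ ≤ ∑ y, ∑ z, if y = z then G.adjMatrix ℝ v y else 0 := by
        refine sum_le_sum fun y _ => sum_le_sum fun z _ => ?_
        rw [degenerateTripodWeight]
        by_cases h : IsSpread G ![0, 1, 1] ![v, y, z]
        · rw [if_pos h]
          exact ite_nonneg (adjMatrix_apply_nonneg v y) le_rfl
        · rw [if_neg h]
          exact tripodWeight_zero_one_one_le hg h
    _ = d := by simp only [sum_ite_eq, mem_univ, if_true, sum_adjMatrix_apply hreg]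

theorem sum_two_one_zero_degenerate_le (hg : 5 < G.egirth)
    (hreg : G.IsRegularOfDegree d) (v : V) :
    ∑ y with y 0 = v, degenerateTripodWeight G ![2, 1, 0] y ≤ 2 * (d : ℝ) ^ 2 := by
  rw [sum_filter_apply_zero_eq]
  calc _ ≤ ∑ y, ∑ z, ((if v = z then d * G.adjMatrix ℝ z y else 0)
        + G.adjMatrix ℝ z y * G.adjMatrix ℝ y v) := by
        refine sum_le_sum fun y _ => sum_le_sum fun z _ => ?_
        have hzy := adjMatrix_apply_nonneg (G := G) z y
        rw [degenerateTripodWeight]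
        by_cases h : IsSpread G ![2, 1, 0] ![v, y, z]
        · rw [if_pos h]
          exact add_nonneg (ite_nonneg (mul_nonneg (Nat.cast_nonneg d) hzy) le_rfl)
            (mul_nonneg hzy (adjMatrix_apply_nonneg y v))
        · rw [if_neg h]
          exact tripodWeight_two_one_zero_le hg hreg h
    _ = 2 * (d : ℝ) ^ 2 := by
        simp only [sum_add_distrib, sum_ite_eq, mem_univ, if_true, ← mul_sum, ← sum_mul,
          sum_adjMatrix_apply hreg, sum_adjMatrix_apply_left hreg]
        ring

theorem sum_one_one_two_degenerate_le (hg : 5 < G.egirth)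
    (hreg : G.IsRegularOfDegree d) (v : V) :
    ∑ y with y 0 = v, degenerateTripodWeight G ![1, 1, 2] y ≤ 4 * (d : ℝ) ^ 3 := by
  rw [sum_filter_apply_zero_eq]
  calc _ ≤ ∑ y, ∑ z, ∑ m, G.adjMatrix ℝ m v * G.adjMatrix ℝ m y *
          ((if v = y then (G.adjMatrix ℝ ^ 2) m z else 0) + (if m = z then (d : ℝ) else 0)
            + G.adjMatrix ℝ z v + G.adjMatrix ℝ z y) := by
        refine sum_le_sum fun y _ => sum_le_sum fun z _ => ?_
        rw [degenerateTripodWeight]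
        by_cases h : IsSpread G ![1, 1, 2] ![v, y, z]
        · rw [if_pos h]
          refine sum_nonneg fun m _ => mul_nonneg (mul_nonneg (adjMatrix_apply_nonneg _ _)
            (adjMatrix_apply_nonneg _ _)) (add_nonneg (add_nonneg (add_nonneg
              (ite_nonneg (adjMatrix_pow_apply_nonneg _ _ _) le_rfl)
              (ite_nonneg (Nat.cast_nonneg d) le_rfl)) (adjMatrix_apply_nonneg _ _))
              (adjMatrix_apply_nonneg _ _))
        · rw [if_neg h]
          exact tripodWeight_one_one_two_le hg hreg h
    _ = ∑ m, ∑ y, G.adjMatrix ℝ m v * G.adjMatrix ℝ m y *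
          ((if v = y then (d : ℝ) ^ 2 else 0) + 3 * d) := by
        rw [sum_comm_cycle]
        refine sum_congr rfl fun m _ => sum_congr rfl fun y _ => ?_
        rw [← mul_sum]
        simp only [sum_add_distrib, sum_ite_irrel, sum_const_zero, sum_ite_eq, mem_univ, if_true,
          sum_adjMatrix_pow_apply hreg, sum_adjMatrix_apply_left hreg]
        ring
    _ ≤ 4 * (d : ℝ) ^ 3 := by
        simp only [mul_add, sum_add_distrib, mul_ite, mul_zero, sum_ite_eq, mem_univ, if_true,
          ← mul_sum, ← sum_mul, sum_adjMatrix_apply hreg, sum_adjMatrix_apply_left hreg]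
        have hsq : ∑ m, G.adjMatrix ℝ m v * G.adjMatrix ℝ m v ≤ d := by
          rw [← sum_adjMatrix_apply_left hreg v]
          exact sum_le_sum fun m _ =>
            mul_le_of_le_one_right (adjMatrix_apply_nonneg m v) (adjMatrix_apply_le_one m v)
        linarith [mul_le_mul_of_nonneg_right hsq (sq_nonneg (d : ℝ))]

end RootedSums

section TripodCount

open Matrix

/-- `IsTripod G X` says that in each coordinate `X 0`, `X 1`, `X 2` have the mutual distances of the
ends of a tripod. -/
def IsTripod {V : Type*} (G : SimpleGraph V) (X : Fin 3 → Fin 3 → V) : Prop :=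
  ∀ i, IsSpread G (fun r => tripodLegs r i) fun r => X r i

theorem prod_le_ite_add_sum_prod_ite {ι : Type*} [Fintype ι] [DecidableEq ι] {P : Prop}
    [Decidable P] {w w' : ι → ℝ} (hw0 : ∀ i, 0 ≤ w i) (hw'0 : ∀ i, 0 ≤ w' i)
    (hw1 : P → ∀ i, w i ≤ 1) (hw' : ¬ P → ∃ i, w' i = w i) :
    ∏ i, w i ≤ (if P then 1 else 0) + ∑ i, ∏ j, if j = i then w' j else w j := by
  have hnonneg : ∀ i, 0 ≤ ∏ j, if j = i then w' j else w j := fun i =>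
    prod_nonneg fun j _ => ite_nonneg (hw'0 j) (hw0 j)
  by_cases h : P
  · rw [if_pos h]
    exact le_add_of_le_of_nonneg (prod_le_one (fun i _ => hw0 i) fun i _ => hw1 h i)
      (sum_nonneg fun i _ => hnonneg i)
  · rw [if_neg h, zero_add]
    obtain ⟨i, hi⟩ := hw' h
    refine le_trans (le_of_eq (prod_congr rfl fun j _ => ?_))
      (single_le_sum (fun i _ => hnonneg i) (mem_univ i))
    split_ifs with hji
    exacts [(hji ▸ hi).symm, rfl]

variable {V : Type*} [Fintype V] [DecidableEq V] {G : SimpleGraph V} [DecidableRel G.Adj] {d : ℕ}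

theorem tripodLegs_column (i : Fin 3) :
    (fun r => tripodLegs r i) = ![![1, 1, 2], ![2, 1, 0], ![0, 1, 1]] i := by
  revert i
  decide

theorem tripodWeight_tripodLegs_le_one (hg : 4 < G.egirth) (i : Fin 3) {y : Fin 3 → V}
    (h : IsSpread G (fun r => tripodLegs r i) y) :
    tripodWeight (G.adjMatrix ℝ) (fun r => tripodLegs r i) y ≤ 1 := by
  rw [tripodLegs_column] at h ⊢
  obtain ⟨u, v, w, rfl⟩ : ∃ u v w, y = ![u, v, w] := ⟨y 0, y 1, y 2, (FinVec.etaExpand_eq y).symm⟩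
  fin_cases i
  exacts [tripodWeight_one_one_two_le_one hg h, tripodWeight_two_one_zero_le_one hg h,
    tripodWeight_zero_one_one_le_one u v w]

theorem sum_tripodWeight_tripodLegs (hreg : G.IsRegularOfDegree d) (i : Fin 3) (v : V) :
    ∑ y with y 0 = v, tripodWeight (G.adjMatrix ℝ) (fun r => tripodLegs r i) y
      = ![(d : ℝ) ^ 4, (d : ℝ) ^ 3, (d : ℝ) ^ 2] i := by
  rw [tripodLegs_column]
  fin_cases i
  exacts [sum_tripodWeight hreg 1 1 2 v, sum_tripodWeight hreg 2 1 0 v,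
    sum_tripodWeight hreg 0 1 1 v]

theorem sum_tripodLegs_degenerate_le (hg : 5 < G.egirth) (hreg : G.IsRegularOfDegree d)
    (i : Fin 3) (v : V) :
    ∑ y with y 0 = v, degenerateTripodWeight G (fun r => tripodLegs r i) y
      ≤ ![4 * (d : ℝ) ^ 3, 2 * (d : ℝ) ^ 2, (d : ℝ)] i := by
  rw [tripodLegs_column]
  fin_cases i
  exacts [sum_one_one_two_degenerate_le hg hreg v, sum_two_one_zero_degenerate_le hg hreg v,
    sum_zero_one_one_degenerate_le (lt_trans (by norm_num) hg) hreg v]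

open Classical in
theorem prod_mul_prod_tripodWeight_le (hg : 4 < G.egirth)
    {f : Fin 3 → (Fin 3 → V) → ℝ} (hf : ∀ r x, f r x ∈ Set.Icc 0 1) (X : Fin 3 → Fin 3 → V) :
    (∏ r, f r (X r)) * ∏ i, tripodWeight (G.adjMatrix ℝ) (fun r => tripodLegs r i) (fun r => X r i)
      ≤ (if IsTripod G X then ∏ r, f r (X r) else 0)
        + ∑ i, f 0 (X 0) * ∏ j, if j = i
          then degenerateTripodWeight G (fun r => tripodLegs r j) fun r => X r j
          else tripodWeight (G.adjMatrix ℝ) (fun r => tripodLegs r j) fun r => X r j := by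
  have hf_le : ∏ r, f r (X r) ≤ f 0 (X 0) := by
    rw [Fin.prod_univ_succ]
    exact mul_le_of_le_one_right (hf 0 _).1
      (prod_le_one (fun r _ => (hf _ _).1) fun r _ => (hf _ _).2)
  refine (mul_le_mul_of_nonneg_left (prod_le_ite_add_sum_prod_ite
    (P := IsTripod G X) (fun i => tripodWeight_adjMatrix_nonneg _ _)
    (fun i => degenerateTripodWeight_nonneg _ _)
    (fun h i => tripodWeight_tripodLegs_le_one hg i (h i))
    fun h => (not_forall.1 h).imp fun i hi => if_neg hi)
    (prod_nonneg fun r _ => (hf r _).1)).trans ?_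
  rw [mul_add, mul_ite, mul_one, mul_zero, ← mul_sum]
  refine add_le_add_right (mul_le_mul_of_nonneg_right hf_le (sum_nonneg fun i _ => ?_)) _
  exact prod_nonneg fun j _ =>
    ite_nonneg (degenerateTripodWeight_nonneg _ _) (tripodWeight_adjMatrix_nonneg _ _)

theorem sum_prod_sum_ite_degenerate_le (hg : 5 < G.egirth) (hreg : G.IsRegularOfDegree d)
    (x : Fin 3 → V) :
    ∑ i, ∏ j, ∑ y with y 0 = x j, (if j = i
      then degenerateTripodWeight G (fun r => tripodLegs r j) y
      else tripodWeight (G.adjMatrix ℝ) (fun r => tripodLegs r j) y) ≤ 7 * (d : ℝ) ^ 8 := by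
  calc _ ≤ ∑ i, ∏ j, if j = i then ![4 * (d : ℝ) ^ 3, 2 * (d : ℝ) ^ 2, (d : ℝ)] j
        else ![(d : ℝ) ^ 4, (d : ℝ) ^ 3, (d : ℝ) ^ 2] j := by
        refine sum_le_sum fun i _ => prod_le_prod (fun j _ => sum_nonneg fun y _ => ite_nonneg
          (degenerateTripodWeight_nonneg _ _) (tripodWeight_adjMatrix_nonneg _ _)) fun j _ => ?_
        split_ifs
        exacts [sum_tripodLegs_degenerate_le hg hreg j _,
          (sum_tripodWeight_tripodLegs hreg j _).le]
    _ = 7 * (d : ℝ) ^ 8 := by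
        simp only [Fin.sum_univ_three, Fin.prod_univ_three, Fin.isValue, Fin.reduceEq, if_true,
          if_false, one_ne_zero, zero_ne_one, cons_val_zero, cons_val_one, Matrix.cons_val]
        ring

open Classical in
theorem sum_prod_tripodKernel_mulVec_le (hg : 5 < G.egirth) (hreg : G.IsRegularOfDegree d)
    {f : Fin 3 → (Fin 3 → V) → ℝ} (hf : ∀ r x, f r x ∈ Set.Icc 0 1) :
    ∑ m, ∏ r, (tripodKernel (G.adjMatrix ℝ) r *ᵥ f r) m
      ≤ ∑ X with IsTripod G X, ∏ r, f r (X r) + 7 * (d : ℝ) ^ 8 * ∑ x, f 0 x := by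
  refine (sum_prod_tensorKernel_pow_mulVec _ tripodLegs f).trans_le ((sum_le_sum fun X _ =>
    prod_mul_prod_tripodWeight_le (lt_trans (by norm_num) hg) hf X).trans ?_)
  rw [sum_add_distrib, ← sum_filter, sum_comm]
  refine add_le_add_right ?_ _
  have hswap := fun i : Fin 3 => sum_apply_mul_prod_swap (f 0) (fun j y => if j = i
    then degenerateTripodWeight G (fun r => tripodLegs r j) y
    else tripodWeight (G.adjMatrix ℝ) (fun r => tripodLegs r j) y) (0 : Fin 3)
  simp only [hswap]
  rw [sum_comm, mul_sum]
  refine sum_le_sum fun x _ => ?_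
  rw [← mul_sum, mul_comm]
  exact mul_le_mul_of_nonneg_right (sum_prod_sum_ite_degenerate_le hg hreg x) (hf 0 x).1

end TripodCount

section TransversalTriangles

/-- The ordered triangles of a graph whose vertices lie in three prescribed sets. -/
noncomputable def transversalTriangles {W : Type*} [Fintype W] (H : SimpleGraph W)
    (T : Fin 3 → Finset W) : Finset (Fin 3 → W) :=
  open Classical in {X | (∀ r, X r ∈ T r) ∧ Pairwise fun r s => H.Adj (X r) (X s)}

theorem mem_transversalTriangles {W : Type*} [Fintype W] {H : SimpleGraph W}
    {T : Fin 3 → Finset W} {X : Fin 3 → W} : X ∈ transversalTriangles H T ↔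
      (∀ r, X r ∈ T r) ∧ Pairwise fun r s => H.Adj (X r) (X s) := by
  classical rw [transversalTriangles, mem_filter_univ]

end TransversalTriangles

section TripodPatterns

/-- The distance between the ends `r` and `s` of a tripod in the coordinate `i`. -/
def tripodDist (r s i : Fin 3) : ℕ := if r = s then 0 else tripodLegs r i + tripodLegs s i

theorem eq_one_of_tripodDist_comp_perm : ∀ σ ρ : Equiv.Perm (Fin 3),
    (∀ r s i, tripodDist (σ r) (σ s) (ρ i) = tripodDist r s i) → σ = 1 ∧ ρ = 1 := by
  decide

theorem map_tripodDist : ∀ r s : Fin 3, r ≠ s → ∀ ρ : Equiv.Perm (Fin 3),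
    (univ : Finset (Fin 3)).val.map (fun i => tripodDist r s (ρ i)) = {1, 2, 3} := by
  decide

variable {V : Type*} {G : SimpleGraph V} {X : Fin 3 → Fin 3 → V}

theorem IsTripod.edist_eq (h : IsTripod G X) (r s i : Fin 3) :
    G.edist (X r i) (X s i) = tripodDist r s i := by
  rw [tripodDist]
  split_ifs with hrs
  · rw [hrs, SimpleGraph.edist_self, Nat.cast_zero]
  · exact h i hrs

theorem IsTripod.perm_eq {X' : Fin 3 → Fin 3 → V} (h : IsTripod G X) (h' : IsTripod G X')
    {π τ π' τ' : Equiv.Perm (Fin 3)}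
    (heq : ∀ r i, X (π.symm r) (τ i) = X' (π'.symm r) (τ' i)) : π = π' ∧ τ = τ' := by
  obtain ⟨hπ, hτ⟩ := eq_one_of_tripodDist_comp_perm (π.trans π'.symm) (τ.symm.trans τ')
    fun r s i => by
      have hr := heq (π r) (τ.symm i)
      have hs := heq (π s) (τ.symm i)
      simp only [Equiv.symm_apply_apply, Equiv.apply_symm_apply] at hr hs
      exact_mod_cast (h'.edist_eq _ _ _).symm.trans (hr ▸ hs ▸ h.edist_eq r s i)
  exact ⟨Equiv.ext fun r => π'.symm_apply_eq.1 (DFunLike.congr_fun hπ r), Equiv.ext fun i =>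
    ((congrArg τ' (τ.symm_apply_apply i)).symm.trans (DFunLike.congr_fun hτ (τ i))).symm⟩

theorem IsTripod.polygraph_adj (h : IsTripod G X) {r s : Fin 3} (hrs : r ≠ s)
    (τ : Equiv.Perm (Fin 3)) : (polygraph G {1, 2, 3}).Adj (X r ∘ τ) (X s ∘ τ) := by
  have hmap : (univ : Finset (Fin 3)).val.map (fun i => G.edist (X r (τ i)) (X s (τ i)))
      = ({1, 2, 3} : Multiset ℕ).map fun k : ℕ => (k : ℕ∞) := by
    simp only [h.edist_eq, ← map_tripodDist r s hrs τ, Multiset.map_map, Function.comp_def]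
  refine ⟨fun heq => ?_, hmap⟩
  have hzero : (0 : ℕ∞) ∈ ({1, 2, 3} : Multiset ℕ).map fun k : ℕ => (k : ℕ∞) :=
    hmap ▸ Multiset.mem_map.2 ⟨(0 : Fin 3), mem_univ_val _,
      SimpleGraph.edist_eq_zero_iff.2 (congrFun heq (0 : Fin 3))⟩
  simp at hzero

open Classical in
theorem sum_perm_card_isTripod_le [Fintype V] [DecidableEq V] (T : Fin 3 → Finset (Fin 3 → V)) :
    ∑ π : Equiv.Perm (Fin 3), ∑ τ : Equiv.Perm (Fin 3),
        #{X | IsTripod G X ∧ ∀ r, X r ∘ τ ∈ T (π r)}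
      ≤ #(transversalTriangles (W := Fin 3 → V) (polygraph G {1, 2, 3}) T) := by
  rw [← Fintype.sum_prod_type' (f := fun π τ : Equiv.Perm (Fin 3) =>
    #{X | IsTripod G X ∧ ∀ r, X r ∘ τ ∈ T (π r)}), ← card_sigma]
  refine card_le_card_of_injOn (fun q r => q.2 (q.1.1.symm r) ∘ q.1.2) ?_ ?_
  · rintro ⟨⟨π, τ⟩, X⟩ hX
    obtain ⟨htripod, hT⟩ := (mem_filter_univ X).1 (mem_sigma.1 hX).2
    refine mem_transversalTriangles.2 ⟨fun r => ?_, fun r s hrs => ?_⟩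
    · simpa only [Equiv.apply_symm_apply] using hT (π.symm r)
    · exact htripod.polygraph_adj (π.symm.injective.ne hrs) τ
  · rintro ⟨⟨π, τ⟩, X⟩ hX ⟨⟨π', τ'⟩, X'⟩ hX' heq
    have heq' : ∀ r i, X (π.symm r) (τ i) = X' (π'.symm r) (τ' i) := fun r i =>
      congrFun (congrFun heq r) i
    obtain ⟨rfl, rfl⟩ := ((mem_filter_univ X).1 (mem_sigma.1 hX).2).1.perm_eq
      ((mem_filter_univ X').1 (mem_sigma.1 hX').2).1 heq'
    obtain rfl : X = X' := by
      ext r i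
      simpa using heq' (π r) (τ.symm i)
    rfl

end TripodPatterns

section TriangleLowerBound

variable {V : Type*} [Fintype V] [DecidableEq V] {G : SimpleGraph V} [DecidableRel G.Adj] {d : ℕ}

theorem sum_perm_perm_sum_boole (T : Fin 3 → Finset (Fin 3 → V)) :
    ∑ π : Equiv.Perm (Fin 3), ∑ τ : Equiv.Perm (Fin 3),
        ∑ x : Fin 3 → V, (if x ∘ τ ∈ T (π 0) then 1 else 0 : ℝ)
      = 12 * (#(T 0) + #(T 1) + #(T 2)) := by
  have hτ : ∀ (π τ : Equiv.Perm (Fin 3)),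
      ∑ x : Fin 3 → V, (if x ∘ τ ∈ T (π 0) then 1 else 0 : ℝ) = #(T (π 0)) := fun π τ => by
    refine ((τ.symm.arrowCongr (Equiv.refl V)).sum_comp
      fun x => if x ∈ T (π 0) then (1 : ℝ) else 0).trans ?_
    rw [sum_boole, filter_univ_mem]
  simp only [hτ, sum_const, card_univ, Fintype.card_perm, Fintype.card_fin]
  rw [← smul_sum, sum_perm_fin_three fun r _ _ => (#(T r) : ℝ), nsmul_eq_mul]
  norm_num [Nat.factorial]
  ring

open Classical in
theorem le_sum_perm_card_isTripod [Nonempty V] (hg : 5 < G.egirth) (hreg : G.IsRegularOfDegree d)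
    (hd : d ≠ 0) {ε : ℝ} (hε0 : 0 < ε) (hε : ε < 1) (hspec : secondEigenvalue G ≤ ε * d)
    {T : Fin 3 → Finset (Fin 3 → V)} {a b c : ℝ} (ha : (#(T 0) : ℝ) = Fintype.card V ^ 3 * a)
    (hb : (#(T 1) : ℝ) = Fintype.card V ^ 3 * b) (hc : (#(T 2) : ℝ) = Fintype.card V ^ 3 * c) :
    (Fintype.card V : ℝ) ^ 3 * d ^ 9 * (36 * (a * b * c)
        - (12 * ε + 16 * ε ^ 2) * (a * b + b * c + c * a) - 28 * ε ^ 2 * (a + b + c))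
      ≤ (∑ π : Equiv.Perm (Fin 3), ∑ τ : Equiv.Perm (Fin 3),
          #{X | IsTripod G X ∧ ∀ r, X r ∘ τ ∈ T (π r)} : ℕ)
        + 84 * d ^ 8 * (Fintype.card V ^ 3 * (a + b + c)) := by
  have hmean : ∀ r a, (#(T r) : ℝ) = Fintype.card V ^ 3 * a →
      𝔼 x, (if x ∈ T r then 1 else 0 : ℝ) = a := fun r a h => by
    have hV : (Fintype.card V : ℝ) ≠ 0 := Nat.cast_ne_zero.2 Fintype.card_ne_zero
    rw [Fintype.expect_eq_sum_div_card, sum_boole, filter_univ_mem, h, Fintype.card_fun,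
      Fintype.card_fin, Nat.cast_pow, mul_div_cancel_left₀ _ (pow_ne_zero 3 hV)]
  have hindicator : ∀ r (x : Fin 3 → V),
      (if x ∈ T r then 1 else 0 : ℝ) ∈ Set.Icc (0 : ℝ) 1 := fun r x => by
    split_ifs <;> simp
  refine (le_sum_perm_perm_tripod hreg hd hε0 hε hspec hindicator (hmean 0 a ha) (hmean 1 b hb)
    (hmean 2 c hc)).trans ?_
  refine (sum_le_sum fun (π : Equiv.Perm (Fin 3)) _ =>
    sum_le_sum fun (τ : Equiv.Perm (Fin 3)) _ =>
    sum_prod_tripodKernel_mulVec_le hg hreg fun r x => hindicator (π r) (x ∘ τ)).trans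
    (le_of_eq ?_)
  simp only [sum_add_distrib, ← mul_sum, sum_perm_perm_sum_boole]
  push_cast
  simp only [prod_boole, sum_boole, filter_filter, mem_univ, true_implies]
  rw [ha, hb, hc]
  ring

theorem le_card_transversalTriangles_polygraph [Nonempty V] (hg : 5 < G.egirth)
    (hreg : G.IsRegularOfDegree d) (hd : d ≠ 0) {ε : ℝ} (hε0 : 0 < ε) (hε : ε < 1)
    (hspec : secondEigenvalue G ≤ ε * d)
    {T : Fin 3 → Finset (Fin 3 → V)} {a b c : ℝ} (ha : (#(T 0) : ℝ) = Fintype.card V ^ 3 * a)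
    (hb : (#(T 1) : ℝ) = Fintype.card V ^ 3 * b) (hc : (#(T 2) : ℝ) = Fintype.card V ^ 3 * c) :
    (Fintype.card V : ℝ) ^ 3 * d ^ 9 * (36 * (a * b * c)
        - (12 * ε + 16 * ε ^ 2) * (a * b + b * c + c * a) - 28 * ε ^ 2 * (a + b + c)
        - 84 / d * (a + b + c))
      ≤ #(transversalTriangles (W := Fin 3 → V) (polygraph G {1, 2, 3}) T) := by
  classical
  have htripod := le_sum_perm_card_isTripod hg hreg hd hε0 hε hspec ha hb hc
  have hcount : ((_ : ℕ) : ℝ) ≤ _ := Nat.cast_le.2 (sum_perm_card_isTripod_le (G := G) T)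
  have hd8 : (d : ℝ) ^ 9 * (84 / d) = 84 * d ^ 8 := by field_simp
  linear_combination htripod + hcount - Fintype.card V ^ 3 * (a + b + c) * hd8

end TriangleLowerBound

section TriangleLegs

/-- The possible distances in a triangle of `G_{[1,2,3]}` when `G` has no odd closed walk of length
at most `9`: in the `i`-th coordinate, the side opposite to the `r`-th vertex has length
`σ r i + 1`. -/
def evenSides : Finset (Fin 3 → Equiv.Perm (Fin 3)) :=
  {σ | ∀ i, Even (∑ r, ((σ r i : ℕ) + 1))}

/-- The distances from the vertices of a triangle to its center, half the perimeter minus the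
opposite side, when the side opposite to the `r`-th vertex has length `a r + 1`. -/
def triangleLegs (a : Fin 3 → Fin 3) (r : Fin 3) : ℕ :=
  (∑ s, ((a s : ℕ) + 1)) / 2 - ((a r : ℕ) + 1)

theorem card_evenSides : #evenSides = 48 := by
  decide +kernel

theorem triangleLegs_add : ∀ a : Fin 3 → Fin 3, Even (∑ r, ((a r : ℕ) + 1)) → ∀ r,
    triangleLegs a (r + 1) + triangleLegs a (r + 2) = (a r : ℕ) + 1 := by
  decide +kernel

theorem triangleLegs_eq_zero_or : ∀ a : Fin 3 → Fin 3, Even (∑ r, ((a r : ℕ) + 1)) →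
    a ≠ (fun _ => 1) → (∃ r, triangleLegs a r = 0) ∨
      ∃ π : Equiv.Perm (Fin 3), triangleLegs a ∘ π = ![1, 1, 2] := by
  decide +kernel

theorem evenSides_ne_one {σ : Fin 3 → Equiv.Perm (Fin 3)} (hσ : σ ∈ evenSides) (i : Fin 3) :
    (fun r => σ r i) ≠ fun _ => 1 := fun hi => by
  have hodd : ∀ r, Odd ((σ r (i + 1) : ℕ) + 1) := fun r => by
    have hne : σ r (i + 1) ≠ 1 := fun h =>
      (by decide : ∀ i : Fin 3, i + 1 ≠ i) i ((σ r).injective (h.trans (congrFun hi r).symm))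
    exact (by decide : ∀ a : Fin 3, a ≠ 1 → Odd ((a : ℕ) + 1)) _ hne
  have heven := (mem_filter_univ σ).1 hσ (i + 1)
  rw [Fin.sum_univ_three] at heven
  exact Nat.not_even_iff_odd.2 (((hodd 0).add_odd (hodd 1)).add_odd (hodd 2)) heven

theorem sum_triangleLegs {σ : Fin 3 → Equiv.Perm (Fin 3)} (hσ : σ ∈ evenSides) :
    ∑ i, ∑ r, triangleLegs (fun r => σ r i) r = 9 := by
  have hlegs : ∀ i, ∑ r, triangleLegs (fun r => σ r i) r * 2 = ∑ r, ((σ r i : ℕ) + 1) := fun i => by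
    have hadd := triangleLegs_add (fun r => σ r i) ((mem_filter_univ σ).1 hσ i)
    rw [← sum_congr rfl fun r _ => hadd r, sum_add_distrib, ← sum_mul, mul_two]
    exact congrArg₂ (· + ·) (Equiv.sum_comp (Equiv.addRight (1 : Fin 3)) _).symm
      (Equiv.sum_comp (Equiv.addRight (2 : Fin 3)) _).symm
  have hsides : ∀ r, ∑ i, ((σ r i : ℕ) + 1) = 6 := fun r =>
    Equiv.sum_comp (σ r) fun j => (j : ℕ) + 1
  have htotal : (∑ i, ∑ r, triangleLegs (fun r => σ r i) r) * 2 = 18 := by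
    simp only [sum_mul, hlegs]
    rw [sum_comm]
    simp only [hsides, sum_const, card_univ, Fintype.card_fin, smul_eq_mul]
  exact Nat.eq_of_mul_eq_mul_right two_pos htotal

theorem exists_perm_of_map_eq {f : Fin 3 → ℕ∞} (h : (univ : Finset (Fin 3)).val.map f =
    ({1, 2, 3} : Multiset ℕ).map fun k : ℕ => (k : ℕ∞)) :
    ∃ σ : Equiv.Perm (Fin 3), ∀ i, f i = ((σ i : ℕ) + 1 : ℕ) := by
  have hnodup : ((univ : Finset (Fin 3)).val.map f).Nodup :=
    h ▸ Multiset.Nodup.map Nat.cast_injective (by decide)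
  have hmem : ∀ i, ∃ j : Fin 3, f i = ((j : ℕ) + 1 : ℕ) := fun i => by
    have hi : f i ∈ ({1, 2, 3} : Multiset ℕ).map fun k : ℕ => (k : ℕ∞) :=
      h ▸ Multiset.mem_map_of_mem f (mem_univ i)
    obtain ⟨k, hk, hki⟩ := Multiset.mem_map.1 hi
    have hk' : k = 1 ∨ k = 2 ∨ k = 3 := by simpa using hk
    rw [← hki]
    rcases hk' with rfl | rfl | rfl
    exacts [⟨0, rfl⟩, ⟨1, rfl⟩, ⟨2, rfl⟩]
  choose σ hσ using hmem
  have hinj : Function.Injective σ := fun i j hij =>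
    Multiset.inj_on_of_nodup_map hnodup i (mem_univ i) j (mem_univ j) (by rw [hσ i, hσ j, hij])
  exact ⟨Equiv.ofBijective σ (Finite.injective_iff_bijective.1 hinj), hσ⟩

end TriangleLegs

section TriangleUpperBound

variable {V : Type*} {G : SimpleGraph V}

theorem exists_evenSides_isSpread (hg : 9 < G.egirth) {X : Fin 3 → Fin 3 → V}
    (hX : Pairwise fun r s => (polygraph G {1, 2, 3}).Adj (X r) (X s)) :
    ∃ σ ∈ evenSides, ∀ i, IsSpread G (triangleLegs fun r => σ r i) fun r => X r i := by
  have hperm : ∀ r : Fin 3, ∃ σ : Equiv.Perm (Fin 3),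
      ∀ i, G.edist (X (r + 1) i) (X (r + 2) i) = ((σ i : ℕ) + 1 : ℕ) := fun r =>
    exists_perm_of_map_eq (hX (i := r + 1) (j := r + 2) (by decide +revert)).2
  choose σ hσ using hperm
  have hmem : σ ∈ evenSides := (mem_filter_univ σ).2 fun i => by
    have h0 : G.edist (X 1 i) (X 2 i) = _ := hσ 0 i
    have h1 : G.edist (X 2 i) (X 0 i) = _ := hσ 1 i
    have h2 : G.edist (X 0 i) (X 1 i) = _ := hσ 2 i
    rw [SimpleGraph.edist_comm] at h1
    have heven := even_of_edist_eq h2 h1 h0 (hg.trans_le' (by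
      have hlt := fun r => (σ r i).isLt
      exact_mod_cast (by have := hlt 0; have := hlt 1; have := hlt 2; omega)))
    rw [Fin.sum_univ_three]
    convert heven using 1
    ring
  refine ⟨σ, hmem, fun i r s hrs => ?_⟩
  have hside : ∀ r, G.edist (X (r + 1) i) (X (r + 2) i) =
      (triangleLegs (fun r => σ r i) (r + 1) + triangleLegs (fun r => σ r i) (r + 2) : ℕ) := by
    intro r
    rw [hσ, triangleLegs_add _ ((mem_filter_univ σ).1 hmem i)]
  obtain ⟨t, ⟨rfl, rfl⟩ | ⟨rfl, rfl⟩⟩ : ∃ t, r = t + 1 ∧ s = t + 2 ∨ r = t + 2 ∧ s = t + 1 := by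
    decide +revert
  · exact hside t
  · simpa only [SimpleGraph.edist_comm, add_comm] using hside t

theorem IsSpread.exists_center (hg : 8 < G.egirth) {l : Fin 3 → ℕ} (hl : (∃ r, l r = 0) ∨
    ∃ π : Equiv.Perm (Fin 3), l ∘ π = ![1, 1, 2]) {v : Fin 3 → V} (hv : IsSpread G l v) :
    ∃ m, ∀ r, G.edist m (v r) = l r := by
  rcases hl with ⟨r, hr⟩ | ⟨π, hπ⟩
  · refine ⟨v r, fun s => ?_⟩
    rcases eq_or_ne r s with rfl | hrs
    · rw [SimpleGraph.edist_self, hr, Nat.cast_zero]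
    · rw [hv hrs, hr, zero_add]
  · have hspread : ∀ {i j}, i ≠ j → G.edist (v (π i)) (v (π j))
        = ((![1, 1, 2] : Fin 3 → ℕ) i + (![1, 1, 2] : Fin 3 → ℕ) j : ℕ) := fun hij => by
      rw [← hπ]
      exact hv (π.injective.ne hij)
    obtain ⟨m, h0, h1, h2⟩ := exists_adj_adj_edist_eq (k := 2) hg
      (hspread (i := 0) (j := 1) (by decide)) (hspread (i := 0) (j := 2) (by decide))
      (hspread (i := 1) (j := 2) (by decide))
    refine ⟨m, fun r => ?_⟩
    obtain ⟨i, rfl⟩ := π.surjective r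
    rw [show l (π i) = _ from congrFun hπ i]
    fin_cases i
    exacts [SimpleGraph.edist_eq_one_iff_adj.2 h0, SimpleGraph.edist_eq_one_iff_adj.2 h1, h2]

variable [Fintype V] [DecidableRel G.Adj] {d : ℕ}

theorem card_filter_edist_eq_le (hreg : G.IsRegularOfDegree d) (m : V) (k : ℕ) :
    #{u | G.edist m u = k} ≤ d ^ k := by
  classical
  have hone : ∀ u, G.edist m u = k → 1 ≤ (G.adjMatrix ℝ ^ k) m u := fun u hu => by
    obtain ⟨p, hp⟩ := SimpleGraph.exists_walk_of_edist_eq_coe hu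
    rw [G.adjMatrix_pow_apply_eq_card_walk]
    exact_mod_cast Fintype.card_pos_iff.2 ⟨(⟨p, hp⟩ : {p : G.Walk m u | p.length = k})⟩
  suffices (#{u | G.edist m u = k} : ℝ) ≤ d ^ k from mod_cast this
  calc (#{u | G.edist m u = k} : ℝ) = ∑ u with G.edist m u = k, (1 : ℝ) := by simp
    _ ≤ ∑ u with G.edist m u = k, (G.adjMatrix ℝ ^ k) m u :=
        sum_le_sum fun u hu => hone u ((mem_filter_univ u).1 hu)
    _ ≤ ∑ u, (G.adjMatrix ℝ ^ k) m u := sum_le_univ_sum_of_nonneg fun u =>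
        adjMatrix_pow_apply_nonneg k m u
    _ = d ^ k := sum_adjMatrix_pow_apply hreg k m

open Classical in
theorem card_filter_isSpread_le (hg : 8 < G.egirth) (hreg : G.IsRegularOfDegree d)
    {l : Fin 3 → ℕ} (hl : (∃ r, l r = 0) ∨ ∃ π : Equiv.Perm (Fin 3), l ∘ π = ![1, 1, 2]) :
    #{v | IsSpread G l v} ≤ Fintype.card V * d ^ ∑ r, l r := by
  have hcover : ({v | IsSpread G l v} : Finset (Fin 3 → V)) ⊆
      univ.biUnion fun m => Fintype.piFinset fun r => {u | G.edist m u = l r} := fun v hv => by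
    obtain ⟨m, hm⟩ := ((mem_filter_univ v).1 hv).exists_center hg hl
    exact mem_biUnion.2 ⟨m, mem_univ m, Fintype.mem_piFinset.2 fun r =>
      (mem_filter_univ _).2 (hm r)⟩
  refine (card_le_card hcover).trans (card_biUnion_le_card_mul _ _ _ fun m _ => ?_)
  rw [Fintype.card_piFinset, ← prod_pow_eq_pow_sum]
  exact prod_le_prod' fun r _ => card_filter_edist_eq_le hreg m (l r)

open Classical in
theorem card_filter_forall_isSpread_le (hg : 8 < G.egirth) (hreg : G.IsRegularOfDegree d)
    {σ : Fin 3 → Equiv.Perm (Fin 3)} (hσ : σ ∈ evenSides) :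
    #{X : Fin 3 → Fin 3 → V | ∀ i, IsSpread G (triangleLegs fun r => σ r i) fun r => X r i}
      ≤ Fintype.card V ^ 3 * d ^ 9 :=
  calc #{X : Fin 3 → Fin 3 → V | ∀ i, IsSpread G (triangleLegs fun r => σ r i) fun r => X r i}
      ≤ #(Fintype.piFinset fun i => {v | IsSpread G (triangleLegs fun r => σ r i) v}) :=
        card_le_card_of_injOn (fun X i r => X r i)
          (fun X hX => Fintype.mem_piFinset.2 fun i =>
            (mem_filter_univ _).2 ((mem_filter_univ X).1 hX i))
          fun X _ Y _ h => funext fun r => funext fun i => congrFun (congrFun h i) r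
    _ = ∏ i, #{v | IsSpread G (triangleLegs fun r => σ r i) v} := Fintype.card_piFinset _
    _ ≤ ∏ i, Fintype.card V * d ^ ∑ r, triangleLegs (fun r => σ r i) r := prod_le_prod' fun i _ =>
        card_filter_isSpread_le hg hreg (triangleLegs_eq_zero_or _
          ((mem_filter_univ σ).1 hσ i) (evenSides_ne_one hσ i))
    _ = Fintype.card V ^ 3 * d ^ 9 := by
        rw [prod_mul_distrib, prod_const, prod_pow_eq_pow_sum, sum_triangleLegs hσ, card_univ,
          Fintype.card_fin]

theorem card_transversalTriangles_polygraph_le (hg : 9 < G.egirth)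
    (hreg : G.IsRegularOfDegree d) :
    #(transversalTriangles (W := Fin 3 → V) (polygraph G {1, 2, 3}) fun _ => univ)
      ≤ 48 * (Fintype.card V ^ 3 * d ^ 9) := by
  classical
  have hcover : transversalTriangles (W := Fin 3 → V) (polygraph G {1, 2, 3}) (fun _ => univ) ⊆
      evenSides.biUnion fun σ =>
        {X | ∀ i, IsSpread G (triangleLegs fun r => σ r i) fun r => X r i} := fun X hX => by
    obtain ⟨σ, hσ, hspread⟩ := exists_evenSides_isSpread hg (mem_transversalTriangles.1 hX).2
    exact mem_biUnion.2 ⟨σ, hσ, (mem_filter_univ X).2 hspread⟩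
  rw [← card_evenSides]
  exact (card_le_card hcover).trans (card_biUnion_le_card_mul _ _ _ fun σ hσ =>
    card_filter_forall_isSpread_le (hg.trans' (by norm_num)) hreg hσ)

end TriangleUpperBound

section TwoFaces

variable {W : Type*} [DecidableEq W] {H : SimpleGraph W}

theorem image_univ_mem_twoFaces_cliqueComplex {X : Fin 3 → W}
    (hX : Pairwise fun r s => H.Adj (X r) (X s)) : univ.image X ∈ twoFaces (cliqueComplex H) := by
  have hinj : Function.Injective X := fun r s h => by_contra fun hrs => (hX hrs).ne h
  refine ⟨⟨univ_nonempty.image X, ?_⟩, by rw [card_image_of_injective _ hinj, card_fin]⟩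
  rw [coe_image, coe_univ, Set.image_univ]
  rintro _ ⟨r, rfl⟩ _ ⟨s, rfl⟩ hrs
  exact hX fun h => hrs (congrArg X h)

theorem exists_injective_image_univ_eq {s : Finset W} (hs : #s = 3) :
    ∃ X : Fin 3 → W, Function.Injective X ∧ univ.image X = s := by
  refine ⟨fun r => (s.equivFinOfCardEq hs).symm r,
    Subtype.val_injective.comp (s.equivFinOfCardEq hs).symm.injective, coe_injective ?_⟩
  rw [coe_image, coe_univ, Set.image_univ]
  exact ((s.equivFinOfCardEq hs).symm.surjective.range_comp _).trans Subtype.range_val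

theorem eq_of_image_univ_eq {ι κ : Type*} [Fintype κ] [Nonempty κ] {T : ι → κ → Finset W}
    (hT : Pairwise fun a b : ι × κ => Disjoint (T a.1 a.2) (T b.1 b.2)) {X Y : κ → W} {b b' : ι}
    (hX : ∀ r, X r ∈ T b r) (hY : ∀ r, Y r ∈ T b' r) (h : univ.image X = univ.image Y) :
    b = b' ∧ X = Y := by
  have hr : ∀ r, b = b' ∧ X r = Y r := fun r => by
    obtain ⟨s, -, hs⟩ := mem_image.1 (h ▸ mem_image_of_mem X (mem_univ r))
    obtain ⟨rfl, rfl⟩ : b = b' ∧ r = s := Prod.ext_iff.1 (by_contra fun hne =>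
      disjoint_left.1 (hT (i := (b, r)) (j := (b', s)) hne) (hX r) (hs ▸ hY s))
    exact ⟨rfl, hs.symm⟩
  exact ⟨(hr (Classical.arbitrary κ)).1, funext fun r => (hr r).2⟩

variable [Fintype W]

omit [DecidableEq W] in
theorem six_mul_ncard_twoFaces_le (H : SimpleGraph W) :
    6 * (twoFaces (cliqueComplex H)).ncard ≤ #(transversalTriangles H fun _ => univ) := by
  classical
  choose X hXinj hXimage using fun s : twoFaces (cliqueComplex H) =>
    exists_injective_image_univ_eq s.2.2
  have hcard : 6 * (twoFaces (cliqueComplex H)).ncard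
      = #(univ : Finset (Equiv.Perm (Fin 3) × twoFaces (cliqueComplex H))) := by
    rw [card_univ, Fintype.card_prod, Fintype.card_perm, Fintype.card_fin, ← Nat.card_coe_set_eq,
      Nat.card_eq_fintype_card]
    rfl
  rw [hcard]
  refine card_le_card_of_injOn (fun q => X q.2 ∘ q.1) (fun q _ => ?_) ?_
  · have hmem : ∀ r, X q.2 (q.1 r) ∈ (q.2 : Finset W) := fun r =>
      hXimage q.2 ▸ mem_image_of_mem _ (mem_univ _)
    exact mem_transversalTriangles.2 ⟨fun _ => mem_univ _, fun r s hrs =>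
      q.2.2.1.2 (hmem r) (hmem s) ((hXinj q.2).ne (q.1.injective.ne hrs))⟩
  · rintro ⟨π, s⟩ - ⟨π', s'⟩ - h
    have himage : ∀ (π : Equiv.Perm (Fin 3)) s, univ.image (X s ∘ π) = s := fun π s => by
      rw [← image_image, image_univ_equiv, hXimage]
    obtain rfl : s = s' := Subtype.ext
      (((himage π s).symm.trans (congrArg (fun Y => univ.image Y) h)).trans (himage π' s'))
    exact Prod.ext (Equiv.ext fun r => hXinj s (congrFun h r)) rfl

omit [DecidableEq W] in
theorem sum_card_transversalTriangles_le_ncard {ι E : Type*} [Fintype ι] [AddCommGroup E]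
    [Module ℝ E] {f : W → E} {p : E} {T : ι → Fin 3 → Finset W}
    (hT : Pairwise fun a b : ι × Fin 3 => Disjoint (T a.1 a.2) (T b.1 b.2))
    (hp : ∀ b, ∀ v : Fin 3 → W, (∀ i, v i ∈ T b i) → p ∈ convexHull ℝ (Set.range (f ∘ v))) :
    ∑ b, #(transversalTriangles H (T b)) ≤
      {s | s ∈ twoFaces (cliqueComplex H) ∧ p ∈ convexHull ℝ (f '' (s : Set W))}.ncard := by
  classical
  rw [← card_sigma, Set.ncard_eq_toFinset_card']
  refine card_le_card_of_injOn (fun q => univ.image q.2) ?_ ?_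
  · rintro ⟨b, X⟩ hX
    obtain ⟨hXT, hXadj⟩ := mem_transversalTriangles.1 (mem_sigma.1 hX).2
    refine Set.mem_toFinset.2 ⟨image_univ_mem_twoFaces_cliqueComplex hXadj, ?_⟩
    rw [coe_image, coe_univ, Set.image_univ, ← Set.range_comp]
    exact hp b X hXT
  · rintro ⟨b, X⟩ hX ⟨b', Y⟩ hY h
    obtain ⟨rfl, rfl⟩ := eq_of_image_univ_eq hT
      (mem_transversalTriangles.1 (mem_sigma.1 hX).2).1
      (mem_transversalTriangles.1 (mem_sigma.1 hY).2).1 h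
    rfl

end TwoFaces

section Overlap

theorem le_cast_div_six_div {N : ℕ} (hN : 10000 ≤ N) : 0.166 ≤ ((N / 6 : ℕ) : ℝ) / N := by
  have hN' : (10000 : ℝ) ≤ N := mod_cast hN
  have hfloor : (N : ℝ) ≤ 6 * (N / 6 : ℕ) + 6 := by exact_mod_cast (by omega : N ≤ 6 * (N / 6) + 6)
  rw [le_div_iff₀ (by linarith)]
  linarith

theorem overlap_density_ge {κ σ τ δ : ℝ} (hκ : 0.166 ≤ κ) (hστ : σ + τ = 2 * κ)
    (hδ : δ ≤ 84 / 1600) :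
    0.08 ≤ (36 * (κ * σ * σ) - (12 * (1 / 20) + 16 * (1 / 20) ^ 2) * (κ * σ + σ * σ + σ * κ)
        - 28 * (1 / 20) ^ 2 * (κ + σ + σ) - δ * (κ + σ + σ))
      + (36 * (κ * τ * τ) - (12 * (1 / 20) + 16 * (1 / 20) ^ 2) * (κ * τ + τ * τ + τ * κ)
        - 28 * (1 / 20) ^ 2 * (κ + τ + τ) - δ * (κ + τ + τ)) := by
  obtain rfl : τ = 2 * κ - σ := by linarith
  -- Writing `σ = κ + t` and `τ = κ - t`, the coefficient of `t ^ 2` is `72 κ - 1.28`.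
  have hsquare : 0 ≤ (72 * κ - 1.28) * (σ - κ) ^ 2 :=
    mul_nonneg (by linarith) (sq_nonneg _)
  have hcubic : 0.08 ≤ 72 * κ ^ 3 - 3.84 * κ ^ 2 - 0.735 * κ := by
    have hquadratic : 0.6 ≤ 72 * κ ^ 2 - 3.84 * κ - 0.735 := by nlinarith
    nlinarith
  have hδκ : δ * (6 * κ) ≤ 84 / 1600 * (6 * κ) := mul_le_mul_of_nonneg_right hδ (by linarith)
  nlinarith

variable {V : Type*} [Fintype V] [DecidableEq V] {G : SimpleGraph V} [DecidableRel G.Adj] {d : ℕ}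

theorem exists_le_ncard_twoFaces_polygraph [Nonempty V] (hg : 5 < G.egirth)
    (hreg : G.IsRegularOfDegree d) (hd : 1600 < d) (hspec : secondEigenvalue G ≤ 1 / 20 * d)
    {E : Type*} [AddCommGroup E] [Module ℝ E] (φ : E ≃ₗ[ℝ] ℝ × ℝ) {f : (Fin 3 → V) → E}
    (hf : Function.Injective f) :
    ∃ p : E, (Fintype.card V : ℝ) ^ 3 * d ^ 9 * 0.08 ≤
      {s : Finset (Fin 3 → V) | s ∈ twoFaces (cliqueComplex (polygraph G {1, 2, 3})) ∧
        p ∈ convexHull ℝ (f '' (s : Set (Fin 3 → V)))}.ncard := by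
  set N := Fintype.card V ^ 3
  have hcardV : d < Fintype.card V :=
    hreg (Classical.arbitrary V) ▸ G.degree_lt_card_verts (Classical.arbitrary V)
  have hNlarge : 10000 ≤ N :=
    (by norm_num : 10000 ≤ 1600 ^ 3).trans (Nat.pow_le_pow_left (hd.trans hcardV).le 3)
  obtain ⟨p, T, hdisj, hcard, hsum, hp⟩ := exists_overlap_sectors φ hf (k := N / 6) (by omega)
    (by rw [Fintype.card_fun, Fintype.card_fin]; exact Nat.mul_div_le N 6)
  refine ⟨p, ?_⟩
  have hfaces := Nat.cast_le (α := ℝ).2 (sum_card_transversalTriangles_le_ncard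
    (H := polygraph G {1, 2, 3}) hdisj hp)
  rw [Fin.sum_univ_two, Nat.cast_add] at hfaces
  have hN0 : (N : ℝ) ≠ 0 := Nat.cast_ne_zero.2 (by omega)
  have hdensity : ∀ m : ℕ, (m : ℝ) = Fintype.card V ^ 3 * (m / N) := fun m => by
    rw [← Nat.cast_pow, mul_div_cancel₀ _ hN0]
  have htriangles := fun b => le_card_transversalTriangles_polygraph hg hreg (by omega)
    (by norm_num) (by norm_num) hspec (hdensity #(T b 0)) (hdensity #(T b 1))
    (hdensity #(T b 2))
  simp only [(hcard _).1, ← (hcard _).2] at htriangles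
  have hscale := overlap_density_ge (le_cast_div_six_div hNlarge)
    (show (#(T 0 1) : ℝ) / N + #(T 1 1) / N = 2 * ((N / 6 : ℕ) / N) by
      rw [← add_div, ← mul_div_assoc]; exact_mod_cast congrArg (fun m : ℕ => (m : ℝ) / N) hsum)
    (div_le_div_of_nonneg_left (by norm_num) (by norm_num) (Nat.cast_le (α := ℝ).2 hd.le))
  refine ((mul_le_mul_of_nonneg_left hscale (by positivity)).trans ?_).trans hfaces
  rw [mul_add]
  exact add_le_add (htriangles 0) (htriangles 1)

omit [DecidableEq V] in
theorem ncard_twoFaces_polygraph_le (hg : 9 < G.egirth) (hreg : G.IsRegularOfDegree d) :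
    (twoFaces (cliqueComplex (polygraph G {1, 2, 3}))).ncard
      ≤ 8 * (Fintype.card V ^ 3 * d ^ 9) := by
  classical
  have hordered := (six_mul_ncard_twoFaces_le (W := Fin 3 → V) (polygraph G {1, 2, 3})).trans
    (card_transversalTriangles_polygraph_le hg hreg)
  exact Nat.le_of_mul_le_mul_left (hordered.trans_eq (by ring)) (by norm_num : 0 < 6)

end Overlap

theorem mainTheorem4 {V : Type*} [Fintype V] [DecidableEq V]
    (G : SimpleGraph V) [DecidableRel G.Adj] (d : ℕ)
    (hreg : G.IsRegularOfDegree d) (hgirth : 9 < G.egirth)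
    (hd : 1600 < d) (hspec : secondEigenvalue G < (1 / 20 : ℝ) * d) :
    HasGeometricOverlap (cliqueComplex (polygraph G {1, 2, 3})) (1 / 100) := by
  intro f hf
  change (Fin 3 → V) → EuclideanSpace ℝ (Fin 2) at f
  have hfaces : ((twoFaces (cliqueComplex (polygraph G {1, 2, 3}))).ncard : ℝ)
      ≤ 8 * (Fintype.card V ^ 3 * d ^ 9) := mod_cast ncard_twoFaces_polygraph_le hgirth hreg
  rcases isEmpty_or_nonempty V with hV | hV
  · rw [Fintype.card_eq_zero, Nat.cast_zero] at hfaces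
    exact ⟨0, le_trans (by linarith) (Nat.cast_nonneg _)⟩
  · obtain ⟨p, hp⟩ := exists_le_ncard_twoFaces_polygraph (hgirth.trans' (by norm_num)) hreg hd
      hspec.le ((WithLp.linearEquiv 2 ℝ (Fin 2 → ℝ)).trans (LinearEquiv.finTwoArrow ℝ ℝ)) hf
    exact ⟨p, le_trans (by linarith) hp⟩
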